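/- **Model.** The input is a finite simple graph $G$ with $n$ vertices and maximum degree $\Delta$. At every vertex $v$ the incident edges are numbered by distinct ports, and $v$ carries an input label from a finite set $\Sigma_{\mathrm{in}}$. In the $\mathsf{RandLOCAL}$ model all vertices run the same algorithm. A vertex initially knows $n$, $\Delta$, its degree, its port names, its input label and its own independent uniformly random bits. In each synchronous round it sends a message through each of its ports and receives the messages sent by its neighbours. Local computation is free. After a number of rounds fixed in advance it outputs a label from a finite set $\Sigma_{\mathrm{out}}$. An LCL problem $\mathcal P$ of radius $\rho$ is given, for each $\Delta$, by finite alphabets $\Sigma_{\mathrm{in}}(\Delta),\Sigma_{\mathrm{out}}(\Delta)$, a radius $\rho(\Delta)\le\rho$ and a set of acceptable centered configurations (graphs whose vertices carry a degree, a port numbering, an input label and an output label). An output labeling is acceptable if for every $v$ the subgraph induced by the $\rho(\Delta)$-neighbourhood of $v$, with this information, is isomorphic to an acceptable configuration. An algorithm solves $\mathcal P$ w.h.p. if for all $\Delta\ge2$ and $n>\Delta$, on every $n$-vertex graph of maximum degree $\Delta$ with any port numbering and input labels, its output is acceptable with probability at least $1-1/n$. **Theorem.** There is an absolute constant $\epsilon>0$,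 and for every $\rho$ there are positive integer constants $K_0,K$ depending only on $\rho$, such that the following holds. Let $\mathcal P$ be an LCL problem of radius $\rho$, let $C(\Delta)\ge1$ be any function, and let $\mathcal A$ be a $\mathsf{RandLOCAL}$ algorithm that solves $\mathcal P$ w.h.p. in at most $C(\Delta)+\epsilon\log_\Delta n$ rounds, in which each vertex generates $r_\Delta(n)\ge1$ random bits and sends $m_\Delta(n)$-bit messages. Put $\zeta=\zeta(\Delta)=\lceil\Delta^{K_0C(\Delta)}\rceil$, so that $\zeta=\Delta^{\Theta(C(\Delta))}$. Then there is a $\mathsf{RandLOCAL}$ algorithm $\mathcal A'$ that solves $\mathcal P$ w.h.p. and that has the following properties for all $\Delta\ge2$ and all $n>\Delta$ with $n\ge\Delta^{C(\Delta)}$ and $|\Sigma_{\mathrm{in}}(\Delta)|\le n^{\Delta^{C(\Delta)}}$ (which for given $\Delta$ is the case for all large enough $n$): 1. $\mathcal A'$ runs in at most $K\log_\Delta n$ rounds; 2. each vertex generates at most $K\,(\log n+r_\Delta(\zeta)\cdot\log_\zeta n)$ random bits; 3. each message has at most $K\cdot\min\{\log(|\Sigma_{\mathrm{out}}(\Delta)|)\cdot\Delta^{K}+m_\Delta(\zeta)+\zeta,\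 r_\Delta(\zeta)\cdot\zeta\}$ bits. -/

import Mathlib

namespace RandLOCAL

/-- Strings of exactly `b` bits. -/
abbrev Bits (b : ℕ) : Type := Fin b → Bool

/-- An `n`-vertex input graph of the `LOCAL` model: a simple graph, a port numbering of the edges at
each vertex, and an input label at each vertex. The existence of the bijections `port` forces `deg v`
to be the degree of `v`, see `deg_eq_degree`. The ports of `v` are numbered from `0` to `deg v - 1`. -/
structure Network (n : ℕ) (In : Type) where
  graph : SimpleGraph (Fin n)
  deg : Fin n → ℕ
  port : ∀ v, Fin (deg v) ≃ graph.neighborSet v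
  input : Fin n → In

namespace Network

variable {n : ℕ} {In : Type}

theorem deg_eq_degree (N : Network n In) (v : Fin n) [Fintype (N.graph.neighborSet v)] :
    N.deg v = N.graph.degree v := by
  rw [← SimpleGraph.card_neighborSet_eq_degree, ← Fintype.card_congr (N.port v), Fintype.card_fin]

/-- The maximum degree. -/
def maxDegree (N : Network n In) : ℕ := Finset.univ.sup N.deg

/-- The neighbour of `v` at the other end of its port `i`. -/
def nbr (N : Network n In) (v : Fin n) (i : Fin (N.deg v)) : Fin n := (N.port v i).1

theorem adj_nbr (N : Network n In) (v : Fin n) (i : Fin (N.deg v)) :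
    N.graph.Adj v (N.nbr v i) := (N.port v i).2

/-- The port of `v` that leads to its neighbour `u`. -/
def portTo (N : Network n In) (v u : Fin n) (h : N.graph.Adj v u) : Fin (N.deg v) :=
  (N.port v).symm ⟨u, h⟩

/-- The neighbourhood `N^s(v)`: all vertices at distance at most `s` from `v`. The extended distance
is used, so vertices of other components are never included. -/
def ball (N : Network n In) (v : Fin n) (s : ℕ) : Set (Fin n) :=
  {u | N.graph.edist v u ≤ (s : ℕ∞)}

end Network

/-- A centered labeled graph: each vertex has a degree, a port numbering, and two labels. The degree
of a vertex and its port numbers are those of the ambient graph; `port x y` is the number of the port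
of `x` that leads to `y`, and only matters when `x` and `y` are adjacent. -/
structure Config (In Out : Type) where
  size : ℕ
  graph : SimpleGraph (Fin size)
  center : Fin size
  deg : Fin size → ℕ
  port : Fin size → Fin size → ℕ
  input : Fin size → In
  output : Fin size → Out

/-- The subgraph of `N` induced by `N^s(v)`, centered at `v`, together with the vertex degrees, the
port numberings, the input labels and the output labels `out` stored there, is isomorphic to `c`. -/
def Config.IsView {n : ℕ} {In Out : Type} (c : Config In Out) (N : Network n In)
    (out : Fin n → Out) (v : Fin n) (s : ℕ) : Prop :=
  ∃ f : Fin c.size ≃ N.ball v s,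
    (f c.center : Fin n) = v ∧
    (∀ x y, c.graph.Adj x y ↔ N.graph.Adj (f x) (f y)) ∧
    (∀ x, c.deg x = N.deg (f x)) ∧
    (∀ x y, ∀ h : N.graph.Adj (f x) (f y), c.port x y = (N.portTo (f x) (f y) h : ℕ)) ∧
    (∀ x, c.input x = N.input (f x)) ∧
    (∀ x, c.output x = out (f x))

/-- A locally checkable labeling problem: a radius and a set of acceptable configurations. -/
structure LCL (In Out : Type) where
  radius : ℕ
  configs : Set (Config In Out)

/-- `out` is acceptable around `v`. -/
def LCL.AcceptsAt {n : ℕ} {In Out : Type} (P : LCL In Out) (N : Network n In)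
    (out : Fin n → Out) (v : Fin n) : Prop :=
  ∃ c ∈ P.configs, c.IsView N out v P.radius

/-- `out` is an acceptable output for the LCL problem `P` on `N`. -/
def LCL.Accepts {n : ℕ} {In Out : Type} (P : LCL In Out) (N : Network n In)
    (out : Fin n → Out) : Prop :=
  ∀ v, P.AcceptsAt N out v

/-- A randomized synchronous message-passing algorithm in which each vertex generates `r` random bits
and sends a `b`-bit message along each incident edge in each round. All vertices run the same
algorithm, and a vertex initially knows only its degree (and so the names `0, …, d - 1` of its ports),
its input label and its own random bits. Local computation is free and unbounded. Knowledge of the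
global parameters `n` and `Δ` is modeled by families of such algorithms indexed by `Δ` and `n`. -/
structure Algorithm (In Out : Type) (r b : ℕ) where
  /-- the number of rounds -/
  rounds : ℕ
  /-- the possible states of a vertex of given degree -/
  State : ℕ → Type
  init : (d : ℕ) → In → Bits r → State d
  /-- the message sent through a given port -/
  send : (d : ℕ) → State d → Fin d → Bits b
  /-- the new state, given the messages that have arrived through the ports -/
  receive : (d : ℕ) → State d → (Fin d → Bits b) → State d
  output : (d : ℕ) → State d → Out

namespace Algorithm

variable {n r b : ℕ} {In Out : Type}

/-- The states after `t` rounds on `N`, when the vertices have generated the random bits `ρ`. -/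
def stateAt (A : Algorithm In Out r b) (N : Network n In) (ρ : Fin n → Bits r) :
    ℕ → (v : Fin n) → A.State (N.deg v)
  | 0, v => A.init (N.deg v) (N.input v) (ρ v)
  | t + 1, v =>
      A.receive (N.deg v) (A.stateAt N ρ t v) fun i =>
        A.send (N.deg (N.nbr v i)) (A.stateAt N ρ t (N.nbr v i))
          (N.portTo (N.nbr v i) v (N.adj_nbr v i).symm)

/-- The output labeling computed on `N` with random bits `ρ`. -/
def run (A : Algorithm In Out r b) (N : Network n In) (ρ : Fin n → Bits r) (v : Fin n) : Out :=
  A.output (N.deg v) (A.stateAt N ρ A.rounds v)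

/-- The probability, over independent uniformly random bits at all vertices, that the output
labeling is not acceptable. -/
noncomputable def failureProb (A : Algorithm In Out r b) (P : LCL In Out) (N : Network n In) : ℝ :=
  (Nat.card {ρ : Fin n → Bits r // ¬ P.Accepts N (A.run N ρ)} : ℝ) / Nat.card (Fin n → Bits r)

/-- `A` solves `P` with high probability on the `n`-vertex graphs of maximum degree `Δ`: the global
failure probability is at most `1 / n`. -/
def SolvesWHP (A : Algorithm In Out r b) (P : LCL In Out) (Δ n : ℕ) : Prop :=
  ∀ N : Network n In, N.maxDegree = Δ → A.failureProb P N ≤ 1 / (n : ℝ)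

end Algorithm

end RandLOCAL

/-!
Let `A` be the given algorithm for networks of size `ζ = ζ(Δ)`, with `t` rounds, and run it on a
network with `n` vertices. The outcome around a vertex `v` depends only on the ball of some radius
`s = t + O(1)` around `v`, which also occurs in a network of size `ζ`
(`Network.exists_embedded_ball`). So the output is not acceptable around `v` with probability at
most `1 / ζ` (`Algorithm.pr_not_acceptsAt_le`). Each such event shares variables only with the
events within distance `2 * s`, and the choice of the constants makes `ζ` larger than a high power
of `Δ ^ s` (`pow_le_of_rounds_le`). Therefore a distributed form of the Lovász local lemma
applies, with room to spare.

The algorithm is parallel resampling in the manner of Moser and Tardos. Every vertex draws a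
random name, unique with high probability, and a list of samples of the random bits of `A`. In
each step, an unacceptable vertex is selected if it has the smallest name among the unacceptable
vertices within distance `2 * s`, and all vertices within distance `s` of a selected vertex move
on to their next sample. The index of the current sample of a vertex is the number of its
resamplings so far.

If some event still occurs after `k` steps, then going back in time, a selected event always has a
selected event within distance `4 * s` in the preceding step (`exists_selected_pred`). Arranging
the events on which the last one depends as a heap of pieces gives `k + 1` nonempty levels, and
the levels tell which sample each event has read (`exists_witness_of_viol`). Events of the heap
read disjoint parts of the table of samples, so a fixed sequence of levels has probability at most
`p ^ N` for `N` events and `p = 1 / ζ` (`pr_occurs_le`). Since every level is a set of events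
close to events of the level above, the union bound over all sequences is a generating function
that is bounded level by level (`sum_witnesses_le`). It follows that `O(log_ζ n)` steps suffice
(`pr_exists_viol_le`).

For the message sizes, every vertex first learns its view, i.e. the degrees, names and inputs at
the ends of all port walks of length at most `2 * s`, in pieces of the available message size. As
the names are distinct, the view determines the ball up to isomorphism. Afterwards an event can be
evaluated in two ways: by simulating `A` and gathering the outputs (`evaluable_of_simulation`), or
by gathering the random bits of the ball (`evaluable_of_gather_bits`). The cheaper one of the two
gives the minimum in the bound. The other messages of a step only carry one bit for each port
walk. Local computation is free, so to show that a labeling is computable it is enough to show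
that the gathered views determine it (`Computes.of_determined`).
-/

namespace RandLOCAL

/-! ### Uniform probability on finite types -/

/-- The probability of `P` under the uniform distribution on `Ω`. -/
noncomputable def pr {Ω : Type*} (P : Ω → Prop) : ℝ :=
  (Nat.card {ω // P ω} : ℝ) / Nat.card Ω

section pr

variable {Ω Ω' : Type*}

theorem pr_nonneg (P : Ω → Prop) : 0 ≤ pr P := by unfold pr; positivity

theorem pr_mono [Finite Ω] {P Q : Ω → Prop} (h : ∀ ω, P ω → Q ω) : pr P ≤ pr Q := by
  unfold pr
  gcongr
  exact Nat.card_le_card_of_injective (Subtype.map id h)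
    (Subtype.map_injective h Function.injective_id)

theorem pr_equiv (e : Ω ≃ Ω') (P : Ω' → Prop) : pr (fun ω => P (e ω)) = pr P := by
  unfold pr
  rw [Nat.card_congr e, Nat.card_congr (e.subtypeEquiv (p := fun ω => P (e ω)) (q := P)
    fun _ => Iff.rfl)]

theorem pr_false : pr (fun _ : Ω => False) = 0 := by
  simp [pr]

theorem pr_or_le [Finite Ω] (P Q : Ω → Prop) : pr (fun ω => P ω ∨ Q ω) ≤ pr P + pr Q := by
  unfold pr
  rw [← add_div]
  gcongr
  exact_mod_cast Set.ncard_union_le {ω | P ω} {ω | Q ω}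

theorem pr_exists_mem_le [Finite Ω] {ι : Type*} (s : Finset ι) (P : ι → Ω → Prop) :
    pr (fun ω => ∃ i ∈ s, P i ω) ≤ ∑ i ∈ s, pr (P i) := by
  classical
  induction s using Finset.induction_on with
  | empty => simp [pr_false]
  | insert a s ha ih =>
    rw [Finset.sum_insert ha]
    refine le_trans ?_ ((pr_or_le _ _).trans (add_le_add_right ih _))
    refine pr_mono fun ω => ?_
    simp only [Finset.mem_insert]
    rintro ⟨i, rfl | hi, h⟩
    exacts [Or.inl h, Or.inr ⟨i, hi, h⟩]

theorem pr_prod (P : Ω → Prop) (Q : Ω' → Prop) :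
    pr (fun ω : Ω × Ω' => P ω.1 ∧ Q ω.2) = pr P * pr Q := by
  unfold pr
  rw [Nat.card_prod, Nat.card_congr (Equiv.subtypeProdEquivProd (p := P) (q := Q)), Nat.card_prod]
  push_cast
  rw [mul_div_mul_comm]

theorem pr_true [Finite Ω] [Nonempty Ω] : pr (fun _ : Ω => True) = 1 := by
  unfold pr
  rw [Nat.card_congr (Equiv.subtypeUnivEquiv fun _ => trivial)]
  exact div_self (by exact_mod_cast Nat.card_pos.ne')

theorem pr_fst [Finite Ω'] [Nonempty Ω'] (P : Ω → Prop) :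
    pr (fun ω : Ω × Ω' => P ω.1) = pr P := by
  have := pr_prod P (fun _ : Ω' => True)
  simpa [pr_true] using this

theorem pr_snd [Finite Ω] [Nonempty Ω] (P : Ω' → Prop) :
    pr (fun ω : Ω × Ω' => P ω.2) = pr P := by
  have := pr_prod (fun _ : Ω => True) P
  simpa [pr_true] using this

/-- A bound that holds for every value of the first component holds on the product. -/
theorem pr_prod_le [Finite Ω] [Finite Ω'] [Nonempty Ω] (P : Ω → Ω' → Prop) (c : ℝ)
    (h : ∀ ω, pr (P ω) ≤ c) : pr (fun ω : Ω × Ω' => P ω.1 ω.2) ≤ c := by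
  classical
  have := Fintype.ofFinite Ω
  have hc : (Nat.card {ω : Ω × Ω' // P ω.1 ω.2}) = ∑ a : Ω, Nat.card {b // P a b} := by
    rw [← Nat.card_sigma]
    exact Nat.card_congr (Equiv.subtypeProdEquivSigmaSubtype P)
  have hΩ : (0 : ℝ) < Nat.card Ω := by exact_mod_cast Nat.card_pos
  unfold pr
  rw [hc, Nat.card_prod]
  push_cast
  have : ∑ a : Ω, (Nat.card {b // P a b} : ℝ) / Nat.card Ω' ≤ ∑ _a : Ω, c :=
    Finset.sum_le_sum fun a _ => h a
  rw [← Finset.sum_div, Finset.sum_const, Finset.card_univ, ← Nat.card_eq_fintype_card,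
    nsmul_eq_mul] at this
  rw [mul_comm (Nat.card Ω : ℝ), ← div_div, div_le_iff₀ hΩ, mul_comm c]
  exact this

variable {T B S : Type*} [Finite T] [Finite S] [Nonempty S]

/-- Events that depend on disjoint sets of coordinates are independent. -/
theorem pr_and_of_dependsOn {P Q : (T → S) → Prop} {Z : Set T} (hP : DependsOn P Z)
    (hQ : DependsOn Q Zᶜ) : pr (fun x => P x ∧ Q x) = pr P * pr Q := by
  classical
  let e : (T → S) ≃ ({t // t ∈ Z} → S) × ({t // t ∉ Z} → S) :=
    Equiv.piEquivPiSubtypeProd (fun t => t ∈ Z) (fun _ => S)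
  have s : S := Classical.arbitrary S
  let P' : ({t // t ∈ Z} → S) → Prop := fun y => P fun t => if h : t ∈ Z then y ⟨t, h⟩ else s
  let Q' : ({t // t ∉ Z} → S) → Prop := fun y => Q fun t => if h : t ∉ Z then y ⟨t, h⟩ else s
  have h1 : P = fun x => P' (e x).1 := by
    funext x
    refine hP fun t ht => ?_
    simp [e, ht]
  have h2 : Q = fun x => Q' (e x).2 := by
    funext x
    refine hQ fun t ht => ?_
    simp [e, show t ∉ Z from ht]
  have h3 : pr P = pr P' := by
    rw [h1, pr_equiv e (fun ω => P' ω.1), pr_fst]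
  have h4 : pr Q = pr Q' := by
    rw [h2, pr_equiv e (fun ω => Q' ω.2), pr_snd]
  rw [h3, h4, ← pr_prod, ← pr_equiv e, h1, h2]

/-- Restricting a uniform family along an injective reindexing gives a uniform family. -/
theorem pr_comp_injective {π : B → T} (hπ : Function.Injective π) (Q : (B → S) → Prop) :
    pr (fun x : T → S => Q (x ∘ π)) = pr Q := by
  classical
  let e : (T → S) ≃ ({t // t ∈ Set.range π} → S) × ({t // t ∉ Set.range π} → S) :=
    Equiv.piEquivPiSubtypeProd (fun t => t ∈ Set.range π) (fun _ => S)
  let f : ({t // t ∈ Set.range π} → S) ≃ (B → S) :=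
    (Equiv.arrowCongr (Equiv.ofInjective π hπ) (Equiv.refl S)).symm
  have : (fun x : T → S => Q (x ∘ π)) = fun x => Q (f (e x).1) := by
    funext x
    rfl
  rw [this, pr_equiv e (fun ω => Q (f ω.1)), pr_fst (fun ω => Q (f ω)), pr_equiv f]

end pr

/-! ### Parallel resampling and its witness sequences -/

section Resampling

/-- An event is selected for resampling if it occurs under `σ` and has the smallest key among the
occurring events near it. -/
def Selected {V S : Type*} (viol : V → (V → S) → Prop) (near : V → V → Prop) (key : V → ℕ)
    (σ : V → S) (e : V) : Prop :=
  viol e σ ∧ ∀ f, viol f σ → near e f → key e ≤ key f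

open Classical in
/-- The number of times the variable `v` has been resampled after `i` steps of parallel resampling,
where `y v c` is the value of `v` after it has been resampled `c` times. -/
noncomputable def resampleCount {V S : Type*} (viol : V → (V → S) → Prop) (near : V → V → Prop)
    (key : V → ℕ) (vbl : V → Set V) (y : V → ℕ → S) : ℕ → V → ℕ
  | 0, _ => 0
  | i + 1, v => resampleCount viol near key vbl y i v +
      if ∃ e, Selected viol near key
        (fun u => y u (resampleCount viol near key vbl y i u)) e ∧ v ∈ vbl e then 1 else 0

/-- The assignment after `i` steps of parallel resampling. -/
noncomputable def assignment {V S : Type*} (viol : V → (V → S) → Prop) (near : V → V → Prop)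
    (key : V → ℕ) (vbl : V → Set V) (y : V → ℕ → S) (i : ℕ) : V → S :=
  fun v => y v (resampleCount viol near key vbl y i v)

open Classical in
/-- The number of members of a list of sets of events that contain an event on the variable `v`. -/
noncomputable def stackHeight {V : Type*} (vbl : V → Set V) (Ls : List (Finset V)) (v : V) : ℕ :=
  Ls.countP fun L => decide (∃ e ∈ L, v ∈ vbl e)

/-- The sets of events in the list occur as the successive levels, from the last one to the first
one, of a resampling history with table `y`: an event of a level occurs when every variable has been
resampled once for each deeper level on that variable. -/
def Occurs {V S : Type*} (viol : V → (V → S) → Prop) (vbl : V → Set V) (y : V → ℕ → S) :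
    List (Finset V) → Prop
  | [] => True
  | L :: Ls => (∀ e ∈ L, viol e fun v => y v (stackHeight vbl Ls v)) ∧ Occurs viol vbl y Ls

open Classical in
/-- The lists of `h + 1` nonempty sets of events with first member `L` in which every event is
related by `close` to an event of the preceding set. -/
noncomputable def witnesses {V : Type*} [Fintype V] (close : V → V → Prop) :
    ℕ → Finset V → Finset (List (Finset V))
  | 0, L => {[L]}
  | h + 1, L => ((Finset.univ.filter fun f => ∃ e ∈ L, close f e).powerset.filter
      (·.Nonempty)).biUnion fun L' => (witnesses close h L').image (L :: ·)

end Resampling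

/-! ### The heap of resampled events -/

section Heap

open Classical in
/-- A heap of pieces, read backwards in time. The pieces of step `j` are the events with `P j`; an
event rests on all earlier pieces that are `close` to it, and only the pieces that rest directly or
indirectly on `root` are kept. The first component is the height of the heap below `e` just before
step `j`. The second component is the level that `e` gets at step `j`, or `0` if it is not placed. -/
noncomputable def heap {V : Type*} [Fintype V] (close : V → V → Prop) (P : ℕ → V → Prop)
    (root : V) : ℕ → V → ℕ × ℕ
  | 0, e => (0, if e = root then 1 else 0)
  | j + 1, e =>
    let M := max (heap close P root j e).1
      (Finset.univ.sup fun f => if close e f then (heap close P root j f).2 else 0)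
    (M, if P (j + 1) e ∧ 0 < M then M + 1 else 0)

variable {V : Type*} [Fintype V] {close : V → V → Prop} {P : ℕ → V → Prop} {root : V}

theorem heap_top_mono (e : V) : Monotone fun j => (heap close P root j e).1 :=
  monotone_nat_of_le_succ fun j => by
    change _ ≤ max _ _
    exact le_max_left _ _

theorem heap_level_le_top {j j' : ℕ} (hj : j < j') {e f : V} (h : close e f) :
    (heap close P root j f).2 ≤ (heap close P root j' e).1 := by
  classical
  refine le_trans ?_ (heap_top_mono e (Nat.succ_le_of_lt hj))
  change _ ≤ max _ _
  refine le_trans ?_ (le_max_right _ _)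
  have := Finset.le_sup (f := fun f => if close e f then (heap close P root j f).2 else 0)
    (Finset.mem_univ f)
  simpa [h] using this

theorem heap_level_succ {j : ℕ} {e : V} (hP : P (j + 1) e)
    (h : 0 < (heap close P root (j + 1) e).1) :
    (heap close P root (j + 1) e).2 = (heap close P root (j + 1) e).1 + 1 :=
  if_pos ⟨hP, h⟩

theorem heap_level_pos {j : ℕ} {e : V} (h : 0 < (heap close P root (j + 1) e).2) :
    P (j + 1) e ∧ 0 < (heap close P root (j + 1) e).1 := by
  by_contra hc
  exact h.ne' (if_neg hc)

/-- The later of two close pieces lies strictly higher. -/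
theorem heap_level_lt {j j' : ℕ} (hj : j < j') {e f : V} (h : close e f)
    (he : 0 < (heap close P root j' e).2) :
    (heap close P root j f).2 < (heap close P root j' e).2 := by
  obtain _ | j' := j'
  · omega
  · obtain ⟨h1, h2⟩ := heap_level_pos he
    rw [heap_level_succ h1 h2]
    exact Nat.lt_succ_of_le (heap_level_le_top hj h)

theorem exists_heap_level_eq_top {j : ℕ} {e : V} (h : 0 < (heap close P root j e).1) :
    ∃ j' < j, ∃ f, close e f ∧ (heap close P root j' f).2 = (heap close P root j e).1 := by
  classical
  induction j with
  | zero => exact absurd h (lt_irrefl 0)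
  | succ j ih =>
    have hM : (heap close P root (j + 1) e).1 = max (heap close P root j e).1
      (Finset.univ.sup fun f => if close e f then (heap close P root j f).2 else 0) := rfl
    rcases max_choice (heap close P root j e).1
      (Finset.univ.sup fun f => if close e f then (heap close P root j f).2 else 0) with h1 | h1
    · rw [h1] at hM
      rw [hM] at h ⊢
      obtain ⟨j', hj', f, hf⟩ := ih h
      exact ⟨j', hj'.trans (Nat.lt_succ_self j), f, hf⟩
    · rw [h1] at hM
      obtain ⟨f, -, hf⟩ := Finset.exists_mem_eq_sup Finset.univ ⟨root, Finset.mem_univ _⟩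
        (fun f => if close e f then (heap close P root j f).2 else 0)
      rw [hM] at h ⊢
      rw [hf] at h ⊢
      by_cases hc : close e f
      · exact ⟨j, Nat.lt_succ_self j, f, hc, by simp [hc]⟩
      · simp [hc] at h

theorem heap_level_le (j : ℕ) (e : V) : (heap close P root j e).2 ≤ j + 1 := by
  induction j using Nat.strong_induction_on generalizing e with
  | _ j ih =>
    obtain _ | j := j
    · classical
      simp only [heap]
      split_ifs <;> simp
    · rcases Nat.eq_zero_or_pos (heap close P root (j + 1) e).2 with h | h
      · omega
      · obtain ⟨h1, h2⟩ := heap_level_pos h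
        rw [heap_level_succ h1 h2]
        obtain ⟨j', hj', f, -, hf⟩ := exists_heap_level_eq_top h2
        rw [← hf]
        have := ih j' hj' f
        omega

theorem heap_zero_root : (heap close P root 0 root).2 = 1 := if_pos rfl

theorem pred_of_heap_level_pos (h0 : P 0 root) {j : ℕ} {e : V} (h : 0 < (heap close P root j e).2) :
    P j e := by
  classical
  obtain _ | j := j
  · by_cases he : e = root
    · exact he ▸ h0
    · exact absurd (if_neg he) h.ne'
  · exact (heap_level_pos h).1

/-- If every piece has a close piece in the next step, the heap has height one more in each step. -/
theorem exists_heap_level_eq (h0 : P 0 root) {k : ℕ}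
    (hP : ∀ j < k, ∀ e, P j e → ∃ f, P (j + 1) f ∧ close f e) {j : ℕ} (hj : j ≤ k) :
    ∃ e, (heap close P root j e).2 = j + 1 := by
  induction j with
  | zero => exact ⟨root, heap_zero_root⟩
  | succ j ih =>
    obtain ⟨e, he⟩ := ih (by omega)
    obtain ⟨f, hf, hfe⟩ := hP j (by omega) e (pred_of_heap_level_pos (close := close) h0 (by omega))
    have h1 := heap_level_le_top (close := close) (P := P) (root := root) (Nat.lt_succ_self j) hfe
    refine ⟨f, le_antisymm (heap_level_le _ _) ?_⟩
    rw [heap_level_succ hf (by simp only [Nat.succ_eq_add_one] at h1; omega)]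
    simp only [Nat.succ_eq_add_one] at h1
    omega

open Classical in
/-- The events on level `l + 1` of the heap built in the steps up to `k`. -/
noncomputable def heapLevel (close : V → V → Prop) (P : ℕ → V → Prop) (root : V) (k l : ℕ) :
    Finset V :=
  Finset.univ.filter fun e => ∃ j ≤ k, (heap close P root j e).2 = l + 1

theorem mem_heapLevel {k l : ℕ} {e : V} :
    e ∈ heapLevel close P root k l ↔ ∃ j ≤ k, (heap close P root j e).2 = l + 1 := by
  simp [heapLevel]

theorem heapLevel_zero (k : ℕ) : heapLevel close P root k 0 = {root} := by
  ext e
  rw [mem_heapLevel, Finset.mem_singleton]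
  constructor
  · rintro ⟨j, -, hj⟩
    obtain _ | j := j
    · classical
      by_contra he
      have : (heap close P root 0 e).2 = 0 := if_neg he
      omega
    · obtain ⟨h1, h2⟩ := heap_level_pos (close := close) (P := P) (root := root) (j := j) (e := e)
        (by omega)
      rw [heap_level_succ h1 h2] at hj
      omega
  · rintro rfl
    exact ⟨0, Nat.zero_le _, heap_zero_root⟩

theorem exists_close_of_mem_heapLevel_succ {k l : ℕ} {e : V}
    (h : e ∈ heapLevel close P root k (l + 1)) : ∃ f ∈ heapLevel close P root k l, close e f := by
  obtain ⟨j, hj, he⟩ := mem_heapLevel.1 h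
  obtain _ | j := j
  · have := heap_level_le (close := close) (P := P) (root := root) 0 e
    omega
  · obtain ⟨h1, h2⟩ := heap_level_pos (close := close) (P := P) (root := root) (j := j) (e := e)
        (by omega)
    rw [heap_level_succ h1 h2] at he
    obtain ⟨j', hj', f, hf, hl⟩ := exists_heap_level_eq_top h2
    exact ⟨f, mem_heapLevel.2 ⟨j', by omega, by omega⟩, hf⟩

theorem map_heapLevel_mem_witnesses {k : ℕ} (hne : ∀ l ≤ k, (heapLevel close P root k l).Nonempty)
    (m l : ℕ) (h : l + m = k) :
    (List.range' l (m + 1)).map (heapLevel close P root k) ∈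
      witnesses close m (heapLevel close P root k l) := by
  classical
  induction m generalizing l with
  | zero => simp [witnesses]
  | succ m ih =>
    rw [List.range'_succ, List.map_cons, witnesses, Finset.mem_biUnion]
    refine ⟨heapLevel close P root k (l + 1), ?_, Finset.mem_image_of_mem _ (ih (l + 1) (by omega))⟩
    rw [Finset.mem_filter, Finset.mem_powerset]
    refine ⟨fun e he => ?_, hne _ (by omega)⟩
    rw [Finset.mem_filter]
    obtain ⟨f, hf, hc⟩ := exists_close_of_mem_heapLevel_succ he
    exact ⟨Finset.mem_univ _, f, hf, hc⟩

end Heap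

section Resampling

variable {V S : Type*} {viol : V → (V → S) → Prop} {near close : V → V → Prop}
  {key : V → ℕ} {vbl : V → Set V} {y : V → ℕ → S}

open Classical in
theorem resampleCount_succ (i : ℕ) (v : V) :
    resampleCount viol near key vbl y (i + 1) v = resampleCount viol near key vbl y i v +
      if ∃ e, Selected viol near key (assignment viol near key vbl y i) e ∧ v ∈ vbl e
        then 1 else 0 := rfl

theorem exists_selected_of_viol [Finite V] {σ : V → S} {e : V}
    (h : viol e σ) : ∃ f, Selected viol near key σ f := by
  obtain ⟨f, hf, hmin⟩ := (Set.toFinite {f | viol f σ}).exists_minimalFor key _ ⟨e, h⟩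
  refine ⟨f, hf, fun g hg _ => ?_⟩
  by_contra hc
  exact hc (hmin hg (by omega))

theorem eq_of_selected_of_near (hkey : Function.Injective key) (hsymm : ∀ e f, near e f → near f e)
    {σ : V → S} {e f : V} (he : Selected viol near key σ e) (hf : Selected viol near key σ f)
    (h : near e f) : e = f :=
  hkey (le_antisymm (he.2 f hf.1 h) (hf.2 e he.1 (hsymm _ _ h)))

/-- An event that is selected after `i + 1` steps is close to one that was selected after `i` steps:
either one of its own variables was resampled, or it was blocked by a nearby event with smaller key,
which has disappeared since, so that a variable of that event was resampled. -/
theorem exists_selected_pred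
    (hrefl : ∀ e, near e e) (hnear : ∀ e f v, v ∈ vbl e → v ∈ vbl f → near e f)
    (hclose : ∀ e f g, near e f → near f g → close g e)
    (hloc : ∀ e, DependsOn (viol e) (vbl e)) {i : ℕ} {e : V}
    (h : Selected viol near key (assignment viol near key vbl y (i + 1)) e) :
    ∃ f, Selected viol near key (assignment viol near key vbl y i) f ∧ close f e := by
  classical
  by_contra! hno
  have key1 : ∀ g, near e g → viol g (assignment viol near key vbl y (i + 1)) =
      viol g (assignment viol near key vbl y i) := by
    intro g hg
    refine hloc g fun v hv => ?_
    have : ¬ ∃ f, Selected viol near key (assignment viol near key vbl y i) f ∧ v ∈ vbl f := by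
      rintro ⟨f, hf, hvf⟩
      exact hno f hf (hclose e g f hg (hnear g f v hv hvf))
    change y v (resampleCount viol near key vbl y (i + 1) v) = _
    rw [resampleCount_succ, if_neg this]
    rfl
  have h1 : Selected viol near key (assignment viol near key vbl y i) e := by
    refine ⟨(key1 e (hrefl e)).mp h.1, fun f hf hef => h.2 f ((key1 f hef).mpr hf) hef⟩
  exact hno e h1 (hclose e e e (hrefl e) (hrefl e))

theorem resampleCount_eq_card (i : ℕ) (v : V) [DecidablePred fun i' => ∃ e,
    Selected viol near key (assignment viol near key vbl y i') e ∧ v ∈ vbl e] :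
    resampleCount viol near key vbl y i v = ((Finset.range i).filter fun i' =>
      ∃ e, Selected viol near key (assignment viol near key vbl y i') e ∧ v ∈ vbl e).card := by
  classical
  induction i with
  | zero => rfl
  | succ i ih =>
    rw [resampleCount_succ, ih, Finset.range_add_one, Finset.filter_insert]
    by_cases h : ∃ e, Selected viol near key (assignment viol near key vbl y i) e ∧ v ∈ vbl e
    · rw [if_pos h, if_pos h, Finset.card_insert_of_notMem (by simp)]
    · rw [if_neg h, if_neg h]; rfl

theorem stackHeight_map_range' (Lv : ℕ → Finset V) (a m : ℕ) (v : V)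
    [DecidablePred fun l => ∃ e ∈ Lv l, v ∈ vbl e] :
    stackHeight vbl ((List.range' a m).map Lv) v =
      ((Finset.Ico a (a + m)).filter fun l => ∃ e ∈ Lv l, v ∈ vbl e).card := by
  classical
  induction m generalizing a with
  | zero => simp [stackHeight]
  | succ m ih =>
    have hI : Finset.Ico a (a + (m + 1)) = insert a (Finset.Ico (a + 1) (a + 1 + m)) := by
      ext; simp; omega
    rw [List.range'_succ, List.map_cons, stackHeight, List.countP_cons, ← stackHeight, ih, hI,
      Finset.filter_insert]
    by_cases h : ∃ e ∈ Lv a, v ∈ vbl e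
    · rw [if_pos h, if_pos (by simpa using h), Finset.card_insert_of_notMem (by simp)]
    · rw [if_neg h, if_neg (by simpa using h)]; rfl

/-- If an event still occurs after `k` steps of resampling, a witness sequence with `k + 1` levels
occurs, and the events on one level share no variables. -/
theorem exists_witness_of_viol [Fintype V] (hkey : Function.Injective key)
    (hrefl : ∀ e, near e e) (hsymm : ∀ e f, near e f → near f e)
    (hnear : ∀ e f v, v ∈ vbl e → v ∈ vbl f → near e f)
    (hclose : ∀ e f g, near e f → near f g → close g e)
    (hloc : ∀ e, DependsOn (viol e) (vbl e)) {k : ℕ} {e₀ : V}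
    (h₀ : viol e₀ (assignment viol near key vbl y k)) :
    ∃ root, ∃ Ls ∈ witnesses close k {root},
      (∀ L ∈ Ls, (L : Set V).PairwiseDisjoint vbl) ∧ Occurs viol vbl y Ls := by
  classical
  obtain ⟨root, hroot⟩ := exists_selected_of_viol (near := near) (key := key) h₀
  let P : ℕ → V → Prop := fun j e =>
    Selected viol near key (assignment viol near key vbl y (k - j)) e
  have hP0 : P 0 root := hroot
  have hcl : ∀ e f v, v ∈ vbl e → v ∈ vbl f → close e f := fun e f v he hf =>
    hclose f f e (hrefl f) (hnear f e v hf he)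
  have hchain : ∀ j < k, ∀ e, P j e → ∃ f, P (j + 1) f ∧ close f e := by
    intro j hj e he
    have hkj : k - j = (k - (j + 1)) + 1 := by omega
    simp only [P] at he ⊢
    rw [hkj] at he
    exact exists_selected_pred hrefl hnear hclose hloc he
  let Lv := heapLevel close P root k
  have hne : ∀ l ≤ k, (Lv l).Nonempty := fun l hl => by
    obtain ⟨e, he⟩ := exists_heap_level_eq (close := close) hP0 hchain hl
    exact ⟨e, mem_heapLevel.2 ⟨l, hl, he⟩⟩
  -- Close pieces on the same level were placed in the same step.
  have hstep : ∀ {j j' e f}, (heap close P root j e).2 = (heap close P root j' f).2 →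
      0 < (heap close P root j e).2 → close e f → close f e → j = j' := by
    intro j j' e f heq hpos h1 h2
    rcases lt_trichotomy j j' with h | h | h
    · have := heap_level_lt (close := close) (P := P) (root := root) h h2 (by omega); omega
    · exact h
    · have := heap_level_lt (close := close) (P := P) (root := root) h h1 (by omega); omega
  have hdisj : ∀ l, ((Lv l : Finset V) : Set V).PairwiseDisjoint vbl := by
    intro l e he f hf hef
    rw [Function.onFun, Set.disjoint_left]
    intro v hve hvf
    obtain ⟨j, -, hje⟩ := mem_heapLevel.1 (Finset.mem_coe.1 he)
    obtain ⟨j', -, hjf⟩ := mem_heapLevel.1 (Finset.mem_coe.1 hf)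
    obtain rfl := hstep (hje.trans hjf.symm) (by omega) (hcl e f v hve hvf) (hcl f e v hvf hve)
    exact hef (eq_of_selected_of_near hkey hsymm (pred_of_heap_level_pos (close := close) hP0 (by omega))
      (pred_of_heap_level_pos (close := close) (j := j) hP0 (by omega)) (hnear e f v hve hvf))
  -- The number of earlier resamplings of a variable is the number of deeper levels on it.
  have hcount : ∀ j ≤ k, ∀ l e v, (heap close P root j e).2 = l + 1 → v ∈ vbl e →
      resampleCount viol near key vbl y (k - j) v =
        stackHeight vbl ((List.range' (l + 1) (k - l)).map Lv) v := by
    intro j hj l e v hl hv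
    have hlj := heap_level_le (close := close) (P := P) (root := root) j e
    rw [resampleCount_eq_card, stackHeight_map_range', show l + 1 + (k - l) = k + 1 by omega]
    have hex : ∀ i' ∈ (Finset.range (k - j)).filter (fun i' =>
        ∃ e, Selected viol near key (assignment viol near key vbl y i') e ∧ v ∈ vbl e),
        ∃ f, v ∈ vbl f ∧ l + 1 < (heap close P root (k - i') f).2 := by
      intro i' hi'
      obtain ⟨hlt, f, hf, hvf⟩ := Finset.mem_filter.1 hi'
      rw [Finset.mem_range] at hlt
      refine ⟨f, hvf, ?_⟩
      have hfe : close f e := hcl f e v hvf hv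
      obtain ⟨j', hj'⟩ : ∃ j', k - i' = j' + 1 := ⟨k - i' - 1, by omega⟩
      have htop := heap_level_le_top (close := close) (P := P) (root := root)
        (show j < j' + 1 by omega) hfe
      have hPf : P (j' + 1) f := by
        simp only [P]
        rwa [show k - (j' + 1) = i' by omega]
      rw [hj', heap_level_succ hPf (by omega)]
      omega
    refine Finset.card_bij
      (fun i' hi' => (heap close P root (k - i') (hex i' hi').choose).2 - 1) ?_ ?_ ?_
    · intro i' hi'
      have h1 := (hex i' hi').choose_spec
      have h2 := heap_level_le (close := close) (P := P) (root := root) (k - i')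
        (hex i' hi').choose
      rw [Finset.mem_filter, Finset.mem_Ico]
      refine ⟨⟨by omega, by omega⟩, _, mem_heapLevel.2 ⟨k - i', by omega, ?_⟩, h1.1⟩
      omega
    · intro i₁ hi₁ i₂ hi₂ heq
      have h1 := (hex i₁ hi₁).choose_spec
      have h2 := (hex i₂ hi₂).choose_spec
      have hr1 := Finset.mem_range.1 (Finset.mem_filter.1 hi₁).1
      have hr2 := Finset.mem_range.1 (Finset.mem_filter.1 hi₂).1
      have := hstep (j := k - i₁) (j' := k - i₂) (e := (hex i₁ hi₁).choose)
        (f := (hex i₂ hi₂).choose) (by omega) (by omega) (hcl _ _ v h1.1 h2.1)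
        (hcl _ _ v h2.1 h1.1)
      omega
    · intro l' hl'
      obtain ⟨hI, f, hf, hvf⟩ := Finset.mem_filter.1 hl'
      rw [Finset.mem_Ico] at hI
      obtain ⟨j', hj'k, hj'⟩ := mem_heapLevel.1 hf
      have hjj : j < j' := by
        rcases lt_trichotomy j j' with h | h | h
        · exact h
        · subst h
          have : e = f := eq_of_selected_of_near hkey hsymm
            (pred_of_heap_level_pos (close := close) (j := j) hP0 (by omega))
            (pred_of_heap_level_pos (close := close) (j := j) hP0 (by omega)) (hnear e f v hv hvf)
          subst this
          omega
        · have := heap_level_lt (close := close) (P := P) (root := root) h (hcl e f v hv hvf)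
            (by omega)
          omega
      have hsel : P j' f := pred_of_heap_level_pos (close := close) hP0 (by omega)
      have hmem : k - j' ∈ (Finset.range (k - j)).filter (fun i' =>
          ∃ e, Selected viol near key (assignment viol near key vbl y i') e ∧ v ∈ vbl e) := by
        rw [Finset.mem_filter, Finset.mem_range]
        exact ⟨by omega, f, hsel, hvf⟩
      refine ⟨k - j', hmem, ?_⟩
      have h1 := (hex _ hmem).choose_spec
      change (heap close P root (k - (k - j')) (hex _ hmem).choose).2 - 1 = l'
      generalize (hex _ hmem).choose = g at h1 ⊢
      rw [show k - (k - j') = j' by omega] at h1 ⊢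
      have hg : P j' g := pred_of_heap_level_pos (close := close) hP0 (by omega)
      have hgf : g = f := eq_of_selected_of_near hkey hsymm hg hsel (hnear _ _ v h1.1 hvf)
      rw [hgf, hj']
      omega
  refine ⟨root, (List.range' 0 (k + 1)).map Lv, ?_, ?_, ?_⟩
  · have := map_heapLevel_mem_witnesses hne k 0 (by omega)
    rwa [heapLevel_zero] at this
  · intro L hL
    obtain ⟨l, -, rfl⟩ := List.mem_map.1 hL
    exact hdisj l
  · have : ∀ m l, l + m = k + 1 → Occurs viol vbl y ((List.range' l m).map Lv) := by
      intro m
      induction m with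
      | zero => intro l _; simp [Occurs]
      | succ m ih =>
        intro l hl
        rw [List.range'_succ, List.map_cons, Occurs]
        refine ⟨fun e he => ?_, ih (l + 1) (by omega)⟩
        obtain ⟨j, hj, hje⟩ := mem_heapLevel.1 he
        have hsel : P j e := pred_of_heap_level_pos (close := close) hP0 (by omega)
        refine (hloc e fun v hv => ?_).mp hsel.1
        rw [assignment, hcount j hj l e v hje hv, show k - l = m by omega]
    exact this (k + 1) 0 (by omega)

end Resampling

/-! ### Probability of a witness sequence -/

section WitnessProbability

variable {V S : Type*} {viol : V → (V → S) → Prop} {vbl : V → Set V}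

/-- A finite table of samples, extended by repeating the last sample of each variable. -/
def extendTable (k : ℕ) (x : V × Fin (k + 1) → S) (v : V) (c : ℕ) : S :=
  x (v, ⟨min c k, Nat.lt_succ_of_le (min_le_right c k)⟩)

theorem stackHeight_le_length (Ls : List (Finset V)) (v : V) :
    stackHeight vbl Ls v ≤ Ls.length := List.countP_le_length

theorem stackHeight_cons_of_mem {L : Finset V} {Ls : List (Finset V)} {v e : V} (he : e ∈ L)
    (hv : v ∈ vbl e) : stackHeight vbl (L :: Ls) v = stackHeight vbl Ls v + 1 := by
  unfold stackHeight
  rw [List.countP_cons_of_pos]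
  simpa using ⟨e, he, hv⟩

theorem stackHeight_le_cons (L : Finset V) (Ls : List (Finset V)) (v : V) :
    stackHeight vbl Ls v ≤ stackHeight vbl (L :: Ls) v := by
  unfold stackHeight
  rw [List.countP_cons]
  omega

theorem dependsOn_occurs (hloc : ∀ e, DependsOn (viol e) (vbl e)) (k : ℕ) (Ls : List (Finset V))
    (hk : Ls.length ≤ k + 1) :
    DependsOn (fun x => Occurs viol vbl (extendTable (S := S) k x) Ls)
      {q | (q.2 : ℕ) < stackHeight vbl Ls q.1} := by
  induction Ls with
  | nil => intro x y _; rfl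
  | cons L Ls ih =>
    intro x y hxy
    simp only [List.length_cons] at hk
    have h1 := ih (by omega) (x := x) (y := y)
      fun q hq => hxy q (lt_of_lt_of_le hq (stackHeight_le_cons L Ls q.1))
    dsimp only at h1 ⊢
    have h2 : ∀ e ∈ L, viol e (fun v => extendTable k x v (stackHeight vbl Ls v)) =
        viol e (fun v => extendTable k y v (stackHeight vbl Ls v)) := by
      intro e he
      refine hloc e fun v hv => hxy _ ?_
      have := stackHeight_le_length (vbl := vbl) Ls v
      simp only [Set.mem_ofPred_eq]
      rw [stackHeight_cons_of_mem he hv]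
      omega
    rw [Occurs, Occurs, h1]
    congr 1
    exact propext (forall₂_congr fun e he => by rw [h2 e he])

variable [Finite V] [Finite S] [Nonempty S]

theorem pr_forall_mem_le (hloc : ∀ e, DependsOn (viol e) (vbl e)) {p : ℝ}
    (hp : ∀ e, pr (viol e) ≤ p) (L : Finset V) (hL : (L : Set V).PairwiseDisjoint vbl) :
    pr (fun σ : V → S => ∀ e ∈ L, viol e σ) ≤ p ^ L.card := by
  classical
  induction L using Finset.induction_on with
  | empty => simp [pr_true]
  | insert a L ha ih =>
    have h0 : (fun σ : V → S => ∀ e ∈ insert a L, viol e σ) =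
        fun σ => viol a σ ∧ ∀ e ∈ L, viol e σ := by
      funext σ; simp
    have h1 : DependsOn (fun σ : V → S => ∀ e ∈ L, viol e σ) (vbl a)ᶜ := by
      intro x y hxy
      refine propext (forall₂_congr fun e he => ?_)
      refine iff_of_eq (hloc e fun v hv => hxy v fun hva => ?_)
      have hne : a ≠ e := fun h => ha (h ▸ he)
      have hd : Disjoint (vbl a) (vbl e) := hL (by simp) (by simp [he]) hne
      exact Set.disjoint_left.1 hd hva hv
    rw [h0, pr_and_of_dependsOn (hloc a) h1, Finset.card_insert_of_notMem ha, pow_succ']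
    have hp0 : 0 ≤ p := (pr_nonneg _).trans (hp a)
    exact mul_le_mul (hp a) (ih (hL.subset (by simp))) (pr_nonneg _) hp0

/-- The levels of a witness sequence read disjoint parts of the table, so they are independent. -/
theorem pr_occurs_le (hloc : ∀ e, DependsOn (viol e) (vbl e)) {p : ℝ} (hp0 : 0 ≤ p)
    (hp : ∀ e, pr (viol e) ≤ p) (k : ℕ) (Ls : List (Finset V)) (hk : Ls.length ≤ k + 1)
    (hL : ∀ L ∈ Ls, (L : Set V).PairwiseDisjoint vbl) :
    pr (fun x => Occurs viol vbl (extendTable (S := S) k x) Ls) ≤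
      (Ls.map fun L => p ^ L.card).prod := by
  classical
  induction Ls with
  | nil => simp [Occurs, pr_true]
  | cons L Ls ih =>
    simp only [List.length_cons] at hk
    have hlen := fun v => stackHeight_le_length (vbl := vbl) Ls v
    let π : V → V × Fin (k + 1) := fun v =>
      (v, ⟨min (stackHeight vbl Ls v) k, Nat.lt_succ_of_le (min_le_right _ _)⟩)
    have hπ : Function.Injective π := fun a b h => (Prod.ext_iff.1 h).1
    have h1 : DependsOn (fun x : V × Fin (k + 1) → S => ∀ e ∈ L, viol e (x ∘ π))
        {q | (q.2 : ℕ) < stackHeight vbl Ls q.1}ᶜ := by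
      intro x y hxy
      refine propext (forall₂_congr fun e he => ?_)
      refine iff_of_eq (hloc e fun v hv => hxy _ ?_)
      have := hlen v
      simp only [π, Set.mem_compl_iff, Set.mem_ofPred_eq]
      omega
    have h2 := pr_and_of_dependsOn (dependsOn_occurs hloc k Ls (by omega)) h1
    have h3 : pr (fun x : V × Fin (k + 1) → S => ∀ e ∈ L, viol e (x ∘ π)) ≤ p ^ L.card := by
      rw [pr_comp_injective hπ (fun σ : V → S => ∀ e ∈ L, viol e σ)]
      exact pr_forall_mem_le hloc hp L (hL L (by simp))
    have h4 : (fun x => Occurs viol vbl (extendTable (S := S) k x) (L :: Ls)) =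
        fun x => Occurs viol vbl (extendTable (S := S) k x) Ls ∧ ∀ e ∈ L, viol e (x ∘ π) := by
      funext x
      rw [Occurs, and_comm]
      rfl
    rw [h4, h2, List.map_cons, List.prod_cons, mul_comm]
    exact mul_le_mul h3 (ih (by omega) fun L' h => hL L' (by simp [h])) (pr_nonneg _)
      (by positivity)

end WitnessProbability

/-! ### Sum over the witness sequences -/

section WitnessSum

variable {V : Type*} [Fintype V] {close : V → V → Prop}

theorem length_of_mem_witnesses {h : ℕ} {L : Finset V} {Ls : List (Finset V)}
    (hLs : Ls ∈ witnesses close h L) : Ls.length = h + 1 := by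
  classical
  induction h generalizing L Ls with
  | zero => simp only [witnesses, Finset.mem_singleton] at hLs; simp [hLs]
  | succ h ih =>
    simp only [witnesses, Finset.mem_biUnion, Finset.mem_image] at hLs
    obtain ⟨L', -, Ls', h', rfl⟩ := hLs
    simp [ih h']

theorem head?_of_mem_witnesses {h : ℕ} {L : Finset V} {Ls : List (Finset V)}
    (hLs : Ls ∈ witnesses close h L) : Ls.head? = some L := by
  classical
  obtain _ | h := h
  · simp only [witnesses, Finset.mem_singleton] at hLs; simp [hLs]
  · simp only [witnesses, Finset.mem_biUnion, Finset.mem_image] at hLs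
    obtain ⟨L', -, Ls', h', rfl⟩ := hLs
    rfl

theorem one_add_pow_sub_one_le {a : ℝ} (ha : 0 ≤ a) {D s : ℕ} (hD : a * D ≤ 1 / 2) :
    (1 + a) ^ (D * s) - 1 ≤ a * D * 4 ^ s := by
  have h1 : (1 + a) ^ D ≤ 2 := by
    calc (1 + a) ^ D ≤ Real.exp a ^ D := by
          gcongr
          rw [add_comm]
          exact Real.add_one_le_exp a
      _ = Real.exp (D * a) := (Real.exp_nat_mul a D).symm
      _ ≤ Real.exp (1 / 2) := by
          gcongr
          linarith
      _ ≤ 2 := by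
          have h := Real.exp_one_lt_d9
          have h2 : Real.exp (1 / 2) * Real.exp (1 / 2) = Real.exp 1 := by
            rw [← Real.exp_add]; norm_num
          nlinarith [Real.exp_pos (1 / 2)]
  have h2 : ∀ m : ℕ, (1 + a) ^ m - 1 ≤ a * m * (1 + a) ^ m := by
    intro m
    induction m with
    | zero => simp
    | succ m ih =>
      have h3 : (1 : ℝ) ≤ (1 + a) ^ m := one_le_pow₀ (by linarith)
      have h4 : (0 : ℝ) ≤ a * a * (1 + a) ^ m := by positivity
      rw [pow_succ]
      push_cast
      nlinarith
  have h3 : ((s : ℕ) : ℝ) ≤ 2 ^ s := by exact_mod_cast Nat.lt_two_pow_self.le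
  calc (1 + a) ^ (D * s) - 1 ≤ a * (D * s : ℕ) * (1 + a) ^ (D * s) := h2 _
    _ = a * D * (s * ((1 + a) ^ D) ^ s) := by rw [pow_mul]; push_cast; ring
    _ ≤ a * D * (2 ^ s * 2 ^ s) := by gcongr
    _ = a * D * 4 ^ s := by rw [← mul_pow]; norm_num

/-- The generating function of the witness sequences, bounded by induction on the number of levels:
the nonempty sets `L'` of events close to `L` contribute `∑ a ^ |L'| = (1 + a) ^ m - 1`, where `m` is
at most `D * |L|`. -/
theorem sum_witnesses_le {p : ℝ} (hp : 0 ≤ p) {D : ℕ} (hpD : 8 * p * D ≤ 1)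
    (hD : ∀ e, Nat.card {f // close f e} ≤ D) (h : ℕ) (L : Finset V) :
    ∑ Ls ∈ witnesses close h L, (Ls.map fun L => p ^ L.card).prod ≤
      (4 * p) ^ L.card * (4 * p * D) ^ h := by
  classical
  induction h generalizing L with
  | zero =>
    simp only [witnesses, Finset.sum_singleton, List.map_cons, List.map_nil, List.prod_cons,
      List.prod_nil, mul_one, pow_zero]
    gcongr
    linarith
  | succ h ih =>
    let N : Finset V := Finset.univ.filter fun f => ∃ e ∈ L, close f e
    have hN : N.card ≤ D * L.card := by
      have : N ⊆ L.biUnion fun e => Finset.univ.filter fun f => close f e := by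
        intro f hf
        simpa [N] using hf
      refine (Finset.card_le_card this).trans (Finset.card_biUnion_le.trans ?_)
      rw [mul_comm, ← smul_eq_mul]
      refine Finset.sum_le_card_nsmul _ _ _ fun e _ => ?_
      rw [← Fintype.card_subtype, ← Nat.card_eq_fintype_card]
      exact hD e
    have h1 : ∑ L' ∈ N.powerset.filter (·.Nonempty), (4 * p) ^ L'.card =
        (1 + 4 * p) ^ N.card - 1 := by
      have h2 : N.powerset.filter (·.Nonempty) = N.powerset.erase ∅ := by
        ext L'
        simp only [Finset.mem_filter, Finset.mem_erase, Finset.nonempty_iff_ne_empty]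
        tauto
      rw [h2, Finset.sum_erase_eq_sub (by simp), Finset.card_empty, pow_zero]
      congr 1
      have := Finset.sum_pow_mul_eq_add_pow (4 * p) 1 N
      simp only [one_pow, mul_one] at this
      rw [this, add_comm]
    have h3 : (1 + 4 * p) ^ N.card - 1 ≤ 4 * p * D * 4 ^ L.card := by
      refine le_trans ?_ (one_add_pow_sub_one_le (a := 4 * p) (by linarith) (by linarith))
      gcongr
      linarith
    have h0 : 0 ≤ (4 * p * D) ^ h := by positivity
    calc ∑ Ls ∈ witnesses close (h + 1) L, (Ls.map fun L => p ^ L.card).prod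
        = ∑ L' ∈ N.powerset.filter (·.Nonempty),
            ∑ Ls ∈ (witnesses close h L').image (L :: ·), (Ls.map fun L => p ^ L.card).prod := by
          rw [witnesses]
          refine Finset.sum_biUnion fun L₁ _ L₂ _ hne => Finset.disjoint_left.2 fun Ls h₁ h₂ => ?_
          obtain ⟨Ls₁, hm₁, rfl⟩ := Finset.mem_image.1 h₁
          obtain ⟨Ls₂, hm₂, he⟩ := Finset.mem_image.1 h₂
          rw [(List.cons.inj he).2] at hm₂
          exact hne (Option.some.inj ((head?_of_mem_witnesses hm₁).symm.trans
            (head?_of_mem_witnesses hm₂)))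
      _ = ∑ L' ∈ N.powerset.filter (·.Nonempty),
            p ^ L.card * ∑ Ls ∈ witnesses close h L', (Ls.map fun L => p ^ L.card).prod := by
          refine Finset.sum_congr rfl fun L' _ => ?_
          rw [Finset.sum_image (fun _ _ _ _ h => (List.cons.inj h).2), Finset.mul_sum]
          exact Finset.sum_congr rfl fun Ls _ => by simp
      _ ≤ ∑ L' ∈ N.powerset.filter (·.Nonempty),
            p ^ L.card * ((4 * p) ^ L'.card * (4 * p * D) ^ h) := by
          gcongr with L' _
          exact ih L'
      _ = p ^ L.card * ((1 + 4 * p) ^ N.card - 1) * (4 * p * D) ^ h := by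
          rw [← h1, Finset.mul_sum, Finset.sum_mul]
          exact Finset.sum_congr rfl fun _ _ => by ring
      _ ≤ p ^ L.card * (4 * p * D * 4 ^ L.card) * (4 * p * D) ^ h := by gcongr
      _ = (4 * p) ^ L.card * (4 * p * D) ^ (h + 1) := by rw [mul_pow]; ring

end WitnessSum

/-- Parallel resampling with a table of independent samples: the probability that an event still
occurs after `k` steps decreases exponentially in `k`. -/
theorem pr_exists_viol_le {V S : Type*} [Fintype V] [Finite S] [Nonempty S]
    {viol : V → (V → S) → Prop} {near close : V → V → Prop} {key : V → ℕ} {vbl : V → Set V}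
    (hkey : Function.Injective key) (hrefl : ∀ e, near e e) (hsymm : ∀ e f, near e f → near f e)
    (hnear : ∀ e f v, v ∈ vbl e → v ∈ vbl f → near e f)
    (hclose : ∀ e f g, near e f → near f g → close g e)
    (hloc : ∀ e, DependsOn (viol e) (vbl e)) {p : ℝ} (hp0 : 0 ≤ p) (hp : ∀ e, pr (viol e) ≤ p)
    {D : ℕ} (hpD : 8 * p * D ≤ 1) (hD : ∀ e, Nat.card {f // close f e} ≤ D) (k : ℕ) :
    pr (fun x : V × Fin (k + 1) → S =>
      ∃ e, viol e (assignment viol near key vbl (extendTable k x) k)) ≤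
      Fintype.card V * (4 * p * (4 * p * D) ^ k) := by
  classical
  let W : V → Finset (List (Finset V)) := fun root =>
    (witnesses close k {root}).filter fun Ls => ∀ L ∈ Ls, (L : Set V).PairwiseDisjoint vbl
  calc pr (fun x : V × Fin (k + 1) → S =>
        ∃ e, viol e (assignment viol near key vbl (extendTable k x) k))
      ≤ pr (fun x : V × Fin (k + 1) → S => ∃ root ∈ (Finset.univ : Finset V),
          ∃ Ls ∈ W root, Occurs viol vbl (extendTable k x) Ls) := by
        refine pr_mono fun x => ?_
        rintro ⟨e, he⟩
        obtain ⟨root, Ls, h1, h2, h3⟩ :=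
          exists_witness_of_viol hkey hrefl hsymm hnear hclose hloc he
        exact ⟨root, Finset.mem_univ _, Ls, Finset.mem_filter.2 ⟨h1, h2⟩, h3⟩
    _ ≤ ∑ root : V, ∑ Ls ∈ W root, (Ls.map fun L => p ^ L.card).prod := by
        refine (pr_exists_mem_le _ _).trans (Finset.sum_le_sum fun root _ => ?_)
        refine (pr_exists_mem_le _ _).trans (Finset.sum_le_sum fun Ls hLs => ?_)
        obtain ⟨h1, h2⟩ := Finset.mem_filter.1 hLs
        exact pr_occurs_le hloc hp0 hp k Ls (length_of_mem_witnesses h1).le h2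
    _ ≤ ∑ root : V, 4 * p * (4 * p * D) ^ k := by
        refine Finset.sum_le_sum fun root _ => ?_
        have h1 := sum_witnesses_le hp0 hpD hD k {root}
        rw [Finset.card_singleton, pow_one] at h1
        refine le_trans (Finset.sum_le_sum_of_subset_of_nonneg (Finset.filter_subset _ _)
          fun Ls _ _ => List.prod_nonneg ?_) h1
        intro x hx
        obtain ⟨L, -, rfl⟩ := List.mem_map.1 hx
        positivity
    _ = Fintype.card V * (4 * p * (4 * p * D) ^ k) := by
        rw [Finset.sum_const, Finset.card_univ, nsmul_eq_mul]

namespace Network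

/-! ### Walks along ports and views -/

variable {n n' : ℕ} {In : Type}

/-- The vertex reached from `v` by following a list of port numbers, if all of them exist. -/
def walk (N : Network n In) : Fin n → List ℕ → Option (Fin n)
  | v, [] => some v
  | v, i :: w => if h : i < N.deg v then N.walk (N.nbr v ⟨i, h⟩) w else none

/-- The labels at the ends of the walks of length at most `j` that start at `v`. -/
def gather {M : Type*} (N : Network n In) (X : Fin n → M) (j : ℕ) (v : Fin n) :
    List ℕ → Option M :=
  fun w => if w.length ≤ j then (N.walk v w).map X else none

/-- `u` is the end of a walk of length at most `j` that starts at `v`. -/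
def Reach (N : Network n In) (j : ℕ) (v u : Fin n) : Prop :=
  ∃ w : List ℕ, w.length ≤ j ∧ N.walk v w = some u

theorem walk_nil (N : Network n In) (v : Fin n) : N.walk v [] = some v := rfl

theorem walk_cons_of_lt (N : Network n In) (v : Fin n) (i : ℕ) (w : List ℕ) (h : i < N.deg v) :
    N.walk v (i :: w) = N.walk (N.nbr v ⟨i, h⟩) w := dif_pos h

theorem walk_cons_of_not_lt (N : Network n In) (v : Fin n) (i : ℕ) (w : List ℕ)
    (h : ¬ i < N.deg v) : N.walk v (i :: w) = none := dif_neg h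

theorem walk_append (N : Network n In) (v : Fin n) (w w' : List ℕ) :
    N.walk v (w ++ w') = (N.walk v w).bind fun u => N.walk u w' := by
  induction w generalizing v with
  | nil => rfl
  | cons i w ih =>
    by_cases h : i < N.deg v
    · rw [List.cons_append, walk_cons_of_lt _ _ _ _ h, walk_cons_of_lt _ _ _ _ h, ih]
    · rw [List.cons_append, walk_cons_of_not_lt _ _ _ _ h, walk_cons_of_not_lt _ _ _ _ h]; rfl

theorem nbr_portTo (N : Network n In) {v u : Fin n} (h : N.graph.Adj v u) :
    N.nbr v (N.portTo v u h) = u := by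
  simp [nbr, portTo]

theorem portTo_eq_iff (N : Network n In) {v u : Fin n} (h : N.graph.Adj v u) (i : Fin (N.deg v)) :
    N.portTo v u h = i ↔ N.nbr v i = u := by
  rw [portTo, Equiv.symm_apply_eq, eq_comm, Subtype.ext_iff]
  rfl

theorem Reach.refl (N : Network n In) (j : ℕ) (v : Fin n) : N.Reach j v v :=
  ⟨[], by simp, rfl⟩

theorem Reach.mono {N : Network n In} {j j' : ℕ} {v u : Fin n} (h : N.Reach j v u) (hj : j ≤ j') :
    N.Reach j' v u := by
  obtain ⟨w, hw, h⟩ := h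
  exact ⟨w, hw.trans hj, h⟩

theorem Reach.trans {N : Network n In} {j j' : ℕ} {v u x : Fin n} (h : N.Reach j v u)
    (h' : N.Reach j' u x) : N.Reach (j + j') v x := by
  obtain ⟨w, hw, h⟩ := h
  obtain ⟨w', hw', h'⟩ := h'
  refine ⟨w ++ w', by simp; omega, ?_⟩
  rw [walk_append, h]
  exact h'

theorem reach_one_of_adj {N : Network n In} {v u : Fin n} (h : N.graph.Adj v u) :
    N.Reach 1 v u := by
  refine ⟨[(N.portTo v u h : ℕ)], by simp, ?_⟩
  rw [walk_cons_of_lt _ _ _ _ (N.portTo v u h).2, walk_nil, Fin.eta, nbr_portTo]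

theorem reach_zero_iff {N : Network n In} {v u : Fin n} : N.Reach 0 v u ↔ v = u := by
  constructor
  · rintro ⟨w, hw, h⟩
    obtain rfl : w = [] := List.length_eq_zero_iff.1 (by omega)
    simpa [walk_nil] using h
  · rintro rfl
    exact Reach.refl N 0 v

theorem reach_succ_iff {N : Network n In} {j : ℕ} {v u : Fin n} :
    N.Reach (j + 1) v u ↔ v = u ∨ ∃ i, N.Reach j (N.nbr v i) u := by
  constructor
  · rintro ⟨_ | ⟨i, w⟩, hw, h⟩
    · left; simpa [walk_nil] using h
    · right
      by_cases hi : i < N.deg v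
      · rw [walk_cons_of_lt _ _ _ _ hi] at h
        exact ⟨⟨i, hi⟩, w, by simpa using hw, h⟩
      · rw [walk_cons_of_not_lt _ _ _ _ hi] at h
        simp at h
  · rintro (rfl | ⟨i, w, hw, h⟩)
    · exact Reach.refl N _ v
    · refine ⟨(i : ℕ) :: w, by simpa using hw, ?_⟩
      rw [walk_cons_of_lt _ _ _ _ i.2]
      exact h

theorem Reach.symm {N : Network n In} {j : ℕ} {v u : Fin n} (h : N.Reach j v u) :
    N.Reach j u v := by
  induction j generalizing v with
  | zero => rw [reach_zero_iff] at h ⊢; exact h.symm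
  | succ j ih =>
    rcases reach_succ_iff.1 h with rfl | ⟨i, hi⟩
    · exact Reach.refl _ _ _
    · exact (ih hi).trans (reach_one_of_adj (N.adj_nbr v i).symm)

theorem mem_ball_iff_reach (N : Network n In) (v u : Fin n) (s : ℕ) :
    u ∈ N.ball v s ↔ N.Reach s v u := by
  change N.graph.edist v u ≤ (s : ℕ∞) ↔ _
  constructor
  · intro h
    have hr : N.graph.Reachable v u := by
      rw [← SimpleGraph.edist_ne_top_iff_reachable]
      exact ne_top_of_le_ne_top (ENat.natCast_ne_top s) h
    obtain ⟨p, hp⟩ := hr.exists_walk_length_eq_edist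
    rw [← hp, Nat.cast_le] at h
    clear hp hr
    induction p generalizing s with
    | nil => exact Reach.refl _ _ _
    | cons hadj p ih =>
      rw [SimpleGraph.Walk.length_cons] at h
      have := (reach_one_of_adj hadj).trans (ih (s - 1) (by omega))
      exact this.mono (by omega)
  · intro h
    induction s generalizing v with
    | zero =>
      rw [reach_zero_iff] at h
      simp [h]
    | succ s ih =>
      rcases reach_succ_iff.1 h with rfl | ⟨i, hi⟩
      · simp
      · refine (SimpleGraph.edist_triangle (v := N.nbr v i)).trans ?_
        have h1 : N.graph.edist v (N.nbr v i) = 1 :=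
          SimpleGraph.edist_eq_one_iff_adj.2 (N.adj_nbr v i)
        rw [h1, add_comm]
        push_cast
        gcongr
        exact ih _ hi

theorem deg_le_maxDegree (N : Network n In) (v : Fin n) : N.deg v ≤ N.maxDegree :=
  Finset.le_sup (f := N.deg) (Finset.mem_univ v)

/-- The number of vertices within distance `j` is at most the number of port lists. -/
theorem card_reach_le (N : Network n In) {Δ : ℕ} (hΔ : 2 ≤ Δ) (hN : ∀ v, N.deg v ≤ Δ) (j : ℕ)
    (v : Fin n) : Nat.card {u // N.Reach j v u} ≤ Δ ^ (j + 1) := by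
  classical
  suffices h : Nat.card {u // N.Reach j v u} + 1 ≤ Δ ^ (j + 1) by omega
  induction j generalizing v with
  | zero =>
    have : Nat.card {u // N.Reach 0 v u} ≤ 1 := by
      refine Finite.card_le_one_iff_subsingleton.2 ?_
      refine ⟨fun a b => Subtype.ext ?_⟩
      exact (reach_zero_iff.1 a.2).symm.trans (reach_zero_iff.1 b.2)
    rw [zero_add, pow_one]; omega
  | succ j ih =>
    have h1 : Nat.card {u // N.Reach (j + 1) v u} ≤
        1 + ∑ i : Fin (N.deg v), Nat.card {u // N.Reach j (N.nbr v i) u} := by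
      simp only [Nat.card_eq_fintype_card, Fintype.card_subtype]
      have : (Finset.univ.filter fun u => N.Reach (j + 1) v u) ⊆
          {v} ∪ Finset.univ.biUnion fun i =>
            Finset.univ.filter fun u => N.Reach j (N.nbr v i) u := by
        intro u hu
        simp only [Finset.mem_filter, Finset.mem_univ, true_and] at hu
        simp only [Finset.mem_union, Finset.mem_singleton, Finset.mem_biUnion, Finset.mem_filter,
          Finset.mem_univ, true_and]
        exact (reach_succ_iff.1 hu).imp Eq.symm id
      refine (Finset.card_le_card this).trans ((Finset.card_union_le _ _).trans ?_)
      rw [Finset.card_singleton]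
      gcongr
      exact Finset.card_biUnion_le
    have h2 : ∑ i : Fin (N.deg v), Nat.card {u // N.Reach j (N.nbr v i) u} ≤
        N.deg v * (Δ ^ (j + 1) - 1) := by
      refine (Finset.sum_le_card_nsmul _ _ (Δ ^ (j + 1) - 1) fun i _ => ?_).trans (by simp)
      have := ih (N.nbr v i)
      omega
    have h3 : N.deg v * (Δ ^ (j + 1) - 1) ≤ Δ * (Δ ^ (j + 1) - 1) := by gcongr; exact hN v
    have h4 : 1 ≤ Δ ^ (j + 1) := Nat.one_le_pow _ _ (by omega)
    obtain ⟨y, hy⟩ : ∃ y, Δ ^ (j + 1) = y + 1 := ⟨Δ ^ (j + 1) - 1, by omega⟩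
    rw [pow_succ, hy]
    rw [hy] at h2 h3
    simp only [Nat.add_sub_cancel] at h2 h3
    nlinarith

/-- The views of radius `j` from `v` in `N` and from `v'` in `N'` agree. -/
def SameView {M : Type*} (N : Network n In) (N' : Network n' In) (X : Fin n → M) (X' : Fin n' → M)
    (j : ℕ) (v : Fin n) (v' : Fin n') : Prop :=
  N.gather X j v = N'.gather X' j v'

section SameView

variable {M : Type*} {N : Network n In} {N' : Network n' In} {X : Fin n → M} {X' : Fin n' → M}
  {j : ℕ} {v : Fin n} {v' : Fin n'}

theorem SameView.symm (h : SameView N N' X X' j v v') : SameView N' N X' X j v' v := Eq.symm h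

theorem SameView.mono {j' : ℕ} (h : SameView N N' X X' j v v') (hj : j' ≤ j) :
    SameView N N' X X' j' v v' := by
  funext w
  have := congrFun h w
  unfold gather at this ⊢
  by_cases hw : w.length ≤ j'
  · rw [if_pos (hw.trans hj), if_pos (hw.trans hj)] at this
    rw [if_pos hw, if_pos hw, this]
  · rw [if_neg hw, if_neg hw]

theorem SameView.apply_eq (h : SameView N N' X X' j v v') : X v = X' v' := by
  have := congrFun h []
  simpa [gather, walk_nil] using this

theorem SameView.of_walk (h : SameView N N' X X' j v v') {w : List ℕ} (hw : w.length ≤ j)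
    {u : Fin n} (hu : N.walk v w = some u) :
    ∃ u', N'.walk v' w = some u' ∧ SameView N N' X X' (j - w.length) u u' := by
  have h1 := congrFun h w
  simp only [gather, hw, if_true, hu, Option.map_some] at h1
  obtain ⟨u', hu', -⟩ := Option.map_eq_some_iff.1 h1.symm
  refine ⟨u', hu', ?_⟩
  funext w'
  have h2 := congrFun h (w ++ w')
  unfold gather at h2 ⊢
  by_cases hw' : w'.length ≤ j - w.length
  · rw [if_pos hw', if_pos hw']
    have hl : (w ++ w').length ≤ j := by simp; omega
    rw [if_pos hl, if_pos hl, walk_append, walk_append, hu, hu'] at h2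
    exact h2
  · rw [if_neg hw', if_neg hw']

theorem SameView.nbr (h : SameView N N' X X' (j + 1) v v') (i : Fin (N.deg v))
    (i' : Fin (N'.deg v')) (hi : (i : ℕ) = i') :
    SameView N N' X X' j (N.nbr v i) (N'.nbr v' i') := by
  obtain ⟨u', hu', h'⟩ := h.of_walk (w := [(i : ℕ)]) (by simp) (u := N.nbr v i) (by
    rw [walk_cons_of_lt _ _ _ _ i.2]; rfl)
  rw [walk_cons_of_lt _ _ _ _ (by rw [hi]; exact i'.2), walk_nil, Option.some.injEq] at hu'
  have : N'.nbr v' i' = u' := by rw [← hu']; congr 1; exact Fin.ext hi.symm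
  rw [this]
  exact h'

end SameView

/-- The label of a vertex that is known initially, together with a name. -/
def baseLabel (N : Network n In) (key : Fin n → ℕ) (u : Fin n) : ℕ × ℕ × In :=
  (N.deg u, key u, N.input u)

/-- The views of radius `j` with degrees, names and inputs agree. -/
abbrev SameBase (N : Network n In) (N' : Network n' In) (key : Fin n → ℕ) (key' : Fin n' → ℕ)
    (j : ℕ) (v : Fin n) (v' : Fin n') : Prop :=
  SameView N N' (N.baseLabel key) (N'.baseLabel key') j v v'

section SameBase

variable {N : Network n In} {N' : Network n' In} {key : Fin n → ℕ} {key' : Fin n' → ℕ}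
  {j : ℕ} {v : Fin n} {v' : Fin n'}

theorem SameView.deg_eq (h : SameBase N N' key key' j v v') : N.deg v = N'.deg v' :=
  congrArg Prod.fst h.apply_eq

theorem SameView.key_eq (h : SameBase N N' key key' j v v') : key v = key' v' :=
  congrArg (fun x => x.2.1) h.apply_eq

theorem SameView.input_eq (h : SameBase N N' key key' j v v') : N.input v = N'.input v' :=
  congrArg (fun x => x.2.2) h.apply_eq

/-- The names determine the neighbour at the end of a port. -/
theorem SameView.nbr_eq (hkey' : Function.Injective key') (h : SameBase N N' key key' (j + 1) v v')
    {u : Fin n} {u' : Fin n'} (hu : key u = key' u') (i : Fin (N.deg v)) (i' : Fin (N'.deg v'))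
    (hi : (i : ℕ) = i') (hnbr : N.nbr v i = u) : N'.nbr v' i' = u' := by
  apply hkey'
  rw [← (h.nbr i i' hi).key_eq, hnbr, hu]

theorem SameView.adj (hkey' : Function.Injective key') (h : SameBase N N' key key' (j + 1) v v')
    {u : Fin n} {u' : Fin n'} (hu : key u = key' u') (ha : N.graph.Adj v u) :
    N'.graph.Adj v' u' := by
  have hlt : (N.portTo v u ha : ℕ) < N'.deg v' := by rw [← h.deg_eq]; exact (N.portTo v u ha).2
  have := h.nbr_eq hkey' hu (N.portTo v u ha) ⟨_, hlt⟩ rfl (N.nbr_portTo ha)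
  rw [← this]
  exact N'.adj_nbr _ _

theorem SameView.portTo_eq (hkey' : Function.Injective key')
    (h : SameBase N N' key key' (j + 1) v v') {u : Fin n} {u' : Fin n'} (hu : key u = key' u')
    (ha : N.graph.Adj v u) (ha' : N'.graph.Adj v' u') :
    (N.portTo v u ha : ℕ) = N'.portTo v' u' ha' := by
  have hlt : (N.portTo v u ha : ℕ) < N'.deg v' := by rw [← h.deg_eq]; exact (N.portTo v u ha).2
  have := h.nbr_eq hkey' hu (N.portTo v u ha) ⟨_, hlt⟩ rfl (N.nbr_portTo ha)
  rw [(N'.portTo_eq_iff ha' _).2 this]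

/-- Acceptance at `v` is determined by the view of `v` if the names are distinct. -/
theorem SameView.acceptsAt {Out : Type} {P : LCL In Out} (hkey : Function.Injective key)
    (hkey' : Function.Injective key') {out : Fin n → Out} {out' : Fin n' → Out}
    (h : SameBase N N' key key' (P.radius + 1) v v')
    (hout : SameView N N' out out' P.radius v v') (hacc : P.AcceptsAt N out v) :
    P.AcceptsAt N' out' v' := by
  obtain ⟨c, hc, f, hf⟩ := hacc
  refine ⟨c, hc, ?_⟩
  let Rel : Fin n → Fin n' → Prop := fun u u' =>
    ∃ w : List ℕ, w.length ≤ P.radius ∧ N.walk v w = some u ∧ N'.walk v' w = some u'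
  have hbase : ∀ {u u'}, Rel u u' → SameBase N N' key key' 1 u u' := by
    rintro u u' ⟨w, hw, hu, hu'⟩
    obtain ⟨x, hx, hs⟩ := h.of_walk (by omega) hu
    obtain rfl : u' = x := Option.some.inj (hu'.symm.trans hx)
    exact hs.mono (by omega)
  have hrout : ∀ {u u'}, Rel u u' → out u = out' u' := by
    rintro u u' ⟨w, hw, hu, hu'⟩
    obtain ⟨x, hx, hs⟩ := hout.of_walk hw hu
    obtain rfl : u' = x := Option.some.inj (hu'.symm.trans hx)
    exact hs.apply_eq
  have hex : ∀ u : N.ball v P.radius, ∃ u' : N'.ball v' P.radius, Rel u u' := by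
    rintro ⟨u, hu⟩
    obtain ⟨w, hw, hu⟩ := (N.mem_ball_iff_reach v u _).1 hu
    obtain ⟨x, hx, -⟩ := h.of_walk (by omega) hu
    exact ⟨⟨x, (N'.mem_ball_iff_reach v' x _).2 ⟨w, hw, hx⟩⟩, w, hw, hu, hx⟩
  choose g hg using hex
  have hgb : Function.Bijective g := by
    constructor
    · intro a b hab
      have ha := (hbase (hg a)).key_eq
      have hb := (hbase (hg b)).key_eq
      rw [hab, ← hb] at ha
      exact Subtype.ext (hkey ha)
    · rintro ⟨u', hu'⟩
      obtain ⟨w, hw, hu'⟩ := (N'.mem_ball_iff_reach v' u' _).1 hu'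
      obtain ⟨u, hu, -⟩ := h.symm.of_walk (by omega) hu'
      have hr : Rel u u' := ⟨w, hw, hu, hu'⟩
      refine ⟨⟨u, (N.mem_ball_iff_reach v u _).2 ⟨w, hw, hu⟩⟩, Subtype.ext (hkey' ?_)⟩
      rw [← (hbase (hg _)).key_eq, (hbase hr).key_eq]
  obtain ⟨h1, h2, h3, h4, h5, h6⟩ := hf
  refine ⟨f.trans (Equiv.ofBijective g hgb), ?_, ?_, ?_, ?_, ?_, ?_⟩
  · apply hkey'
    have := (hbase (hg (f c.center))).key_eq
    rw [h1] at this
    exact this.symm.trans h.key_eq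
  · intro x y
    rw [h2]
    have hx := hbase (hg (f x))
    have hy := (hbase (hg (f y))).key_eq
    exact ⟨fun ha => hx.adj hkey' hy ha, fun ha => hx.symm.adj hkey hy.symm ha⟩
  · intro x
    rw [h3]
    exact (hbase (hg (f x))).deg_eq
  · intro x y ha'
    have hx := hbase (hg (f x))
    have hy := (hbase (hg (f y))).key_eq
    have ha := hx.symm.adj hkey hy.symm ha'
    rw [h4 x y ha]
    exact hx.portTo_eq hkey' hy ha ha'
  · intro x
    rw [h5]
    exact (hbase (hg (f x))).input_eq
  · intro x
    rw [h6]
    exact hrout (hg (f x))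

end SameBase

/-- The messages that arrive at the ports of `v`, when every vertex `u` sends `send u i` through its
port `i`. -/
def inbox {M : Type*} (N : Network n In) (send : Fin n → ℕ → M)
    (v : Fin n) (i : ℕ) : Option M :=
  if h : i < N.deg v then
    some (send (N.nbr v ⟨i, h⟩) (N.portTo (N.nbr v ⟨i, h⟩) v (N.adj_nbr v ⟨i, h⟩).symm))
  else none

end Network

namespace Algorithm

variable {n n' r b : ℕ} {In Out : Type}

/-- The states after `t` rounds, with the degrees made part of the states. -/
def sigmaState (A : Algorithm In Out r b) (N : Network n In) (ρ : Fin n → Bits r) (t : ℕ)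
    (v : Fin n) : Σ d, A.State d := ⟨N.deg v, A.stateAt N ρ t v⟩

/-- The message sent through port `i`, with a default value if there is no such port. -/
def sigmaSend (A : Algorithm In Out r b) (x : Σ d, A.State d) (i : ℕ) : Bits b :=
  if h : i < x.1 then A.send x.1 x.2 ⟨i, h⟩ else fun _ => false

/-- The new state, given the messages that have arrived. -/
def sigmaReceive (A : Algorithm In Out r b) (x : Σ d, A.State d) (f : ℕ → Option (Bits b)) :
    Σ d, A.State d :=
  ⟨x.1, A.receive x.1 x.2 fun i => (f i).getD fun _ => false⟩

theorem sigmaState_succ (A : Algorithm In Out r b) (N : Network n In) (ρ : Fin n → Bits r) (t : ℕ)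
    (v : Fin n) : A.sigmaState N ρ (t + 1) v =
      A.sigmaReceive (A.sigmaState N ρ t v)
        (N.inbox (fun u => A.sigmaSend (A.sigmaState N ρ t u)) v) := by
  unfold sigmaState sigmaReceive
  rw [stateAt]
  dsimp only
  congr 2
  funext i
  simp [Network.inbox, sigmaSend]

theorem run_eq_output_sigmaState (A : Algorithm In Out r b) (N : Network n In)
    (ρ : Fin n → Bits r) (v : Fin n) :
    A.run N ρ v = A.output (A.sigmaState N ρ A.rounds v).1 (A.sigmaState N ρ A.rounds v).2 := rfl

variable {N : Network n In} {N' : Network n' In} {key : Fin n → ℕ} {key' : Fin n' → ℕ}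

/-- The state after `t` rounds is determined by the view of radius `t + 1` and by the random bits
within radius `t`. -/
theorem sigmaState_eq_of_sameView (A : Algorithm In Out r b) (hkey' : Function.Injective key')
    {ρ : Fin n → Bits r} {ρ' : Fin n' → Bits r} (t : ℕ) {v : Fin n} {v' : Fin n'}
    (h : Network.SameBase N N' key key' (t + 1) v v') (hρ : Network.SameView N N' ρ ρ' t v v') :
    A.sigmaState N ρ t v = A.sigmaState N' ρ' t v' := by
  induction t generalizing v v' with
  | zero =>
    unfold sigmaState
    simp only [stateAt]
    rw [h.input_eq, hρ.apply_eq, h.deg_eq]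
  | succ t ih =>
    rw [sigmaState_succ, sigmaState_succ, ih (h.mono (by omega)) (hρ.mono (by omega))]
    congr 1
    funext i
    unfold Network.inbox
    by_cases hi : i < N.deg v
    · have hi' : i < N'.deg v' := by rwa [← h.deg_eq]
      rw [dif_pos hi, dif_pos hi']
      have h1 := h.nbr ⟨i, hi⟩ ⟨i, hi'⟩ rfl
      dsimp only
      rw [ih h1 (hρ.nbr ⟨i, hi⟩ ⟨i, hi'⟩ rfl)]
      rw [h1.portTo_eq hkey' h.key_eq (N.adj_nbr v ⟨i, hi⟩).symm (N'.adj_nbr v' ⟨i, hi'⟩).symm]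
    · rw [dif_neg hi, dif_neg (by rwa [← h.deg_eq])]

theorem run_eq_of_sameView (A : Algorithm In Out r b) (hkey' : Function.Injective key')
    {ρ : Fin n → Bits r} {ρ' : Fin n' → Bits r} {v : Fin n} {v' : Fin n'}
    (h : Network.SameBase N N' key key' (A.rounds + 1) v v')
    (hρ : Network.SameView N N' ρ ρ' A.rounds v v') : A.run N ρ v = A.run N' ρ' v' := by
  rw [run_eq_output_sigmaState, run_eq_output_sigmaState,
    A.sigmaState_eq_of_sameView hkey' _ h hρ]

theorem sameView_run (A : Algorithm In Out r b) (hkey' : Function.Injective key')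
    {ρ : Fin n → Bits r} {ρ' : Fin n' → Bits r} {v : Fin n} {v' : Fin n'} {R : ℕ}
    (h : Network.SameBase N N' key key' (A.rounds + 1 + R) v v')
    (hρ : Network.SameView N N' ρ ρ' (A.rounds + R) v v') :
    Network.SameView N N' (A.run N ρ) (A.run N' ρ') R v v' := by
  funext w
  unfold Network.gather
  by_cases hw : w.length ≤ R
  · rw [if_pos hw, if_pos hw]
    cases hu : N.walk v w with
    | none =>
      cases hu' : N'.walk v' w with
      | none => rfl
      | some u' =>
        obtain ⟨u, hx, -⟩ := h.symm.of_walk (by omega) hu'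
        rw [hu] at hx
        exact absurd hx (by simp)
    | some u =>
      obtain ⟨u', hu', hs⟩ := h.of_walk (by omega) hu
      obtain ⟨x, hx, hs'⟩ := hρ.of_walk (by omega) hu
      obtain rfl : u' = x := Option.some.inj (hu'.symm.trans hx)
      rw [hu', Option.map_some, Option.map_some,
        A.run_eq_of_sameView hkey' (hs.mono (by omega)) (hs'.mono (by omega))]
  · rw [if_neg hw, if_neg hw]

theorem acceptsAt_run_of_sameView (A : Algorithm In Out r b) {P : LCL In Out}
    (hkey : Function.Injective key) (hkey' : Function.Injective key')
    {ρ : Fin n → Bits r} {ρ' : Fin n' → Bits r} {v : Fin n} {v' : Fin n'}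
    (h : Network.SameBase N N' key key' (A.rounds + 1 + P.radius) v v')
    (hρ : Network.SameView N N' ρ ρ' (A.rounds + P.radius) v v')
    (hacc : P.AcceptsAt N (A.run N ρ) v) : P.AcceptsAt N' (A.run N' ρ') v' :=
  Network.SameView.acceptsAt hkey hkey' (h.mono (by omega)) (A.sameView_run hkey' h hρ) hacc

end Algorithm

/-! ### Local failure probability -/

namespace Network

variable {n : ℕ} {In : Type}

/-- The ball of radius `s` around `v` also occurs in a network of any sufficiently large size and of
the same maximum degree: take the subgraph induced by the ball of radius `s + 1` and by a vertex of
maximum degree with its neighbours, and add isolated vertices. -/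
theorem exists_embedded_ball (N : Network n In) {Δ m : ℕ} (hΔ : 2 ≤ Δ) (hN : N.maxDegree = Δ)
    (v : Fin n) (s : ℕ) (hm : Δ ^ (s + 2) + Δ ^ 2 ≤ m) :
    ∃ (N' : Network m In) (B : Set (Fin n)) (e : B ↪ Fin m) (hv : v ∈ B), N'.maxDegree = Δ ∧
      (∀ u : B, N.Reach s v u → N'.deg (e u) = N.deg u ∧ N'.input (e u) = N.input u) ∧
      ∀ w : List ℕ, w.length ≤ s → (N.walk v w = none ∧ N'.walk (e ⟨v, hv⟩) w = none) ∨
        ∃ y : B, N.walk v w = some (y : Fin n) ∧ N'.walk (e ⟨v, hv⟩) w = some (e y) := by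
  classical
  have hdeg : ∀ u, N.deg u ≤ Δ := fun u => hN ▸ N.deg_le_maxDegree u
  obtain ⟨u₀, -, hu₀⟩ := Finset.exists_mem_eq_sup Finset.univ ⟨v, Finset.mem_univ v⟩ N.deg
  have hu₀ : N.deg u₀ = Δ := hu₀.symm.trans hN
  let B : Set (Fin n) := {u | N.Reach (s + 1) v u ∨ N.Reach 1 u₀ u}
  have hcard : Fintype.card B ≤ Fintype.card (Fin m) := by
    rw [Fintype.card_fin, ← Nat.card_eq_fintype_card]
    refine le_trans ?_ hm
    have h1 := N.card_reach_le hΔ hdeg (s + 1) v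
    have h2 := N.card_reach_le hΔ hdeg 1 u₀
    have h3 : Nat.card B ≤ Nat.card {u // N.Reach (s + 1) v u} + Nat.card {u // N.Reach 1 u₀ u} :=
      Set.ncard_union_le {u | N.Reach (s + 1) v u} {u | N.Reach 1 u₀ u}
    exact h3.trans (add_le_add h1 h2)
  obtain ⟨e⟩ := Function.Embedding.nonempty_of_card_le hcard
  let G : SimpleGraph (Fin m) :=
    { Adj := fun a b => ∃ x y : B, N.graph.Adj x y ∧ e x = a ∧ e y = b
      symm := ⟨fun a b ⟨x, y, h, hx, hy⟩ => ⟨y, x, h.symm, hy, hx⟩⟩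
      loopless := ⟨fun a ⟨x, y, h, hx, hy⟩ => by
        obtain rfl : x = y := e.injective (hx.trans hy.symm)
        exact h.ne rfl⟩ }
  let Closed : B → Prop := fun x => ∀ i, N.nbr x i ∈ B
  have hports : ∀ a : Fin m, ∃ (d : ℕ) (p : Fin d ≃ G.neighborSet a), d ≤ Δ ∧
      ∀ x : B, e x = a → Closed x → d = N.deg x ∧ ∀ (i : Fin (N.deg x)) (i' : Fin d),
        (i : ℕ) = i' → ∀ h : N.nbr x i ∈ B, (p i' : Fin m) = e ⟨N.nbr x i, h⟩ := by
    intro a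
    by_cases ha : ∃ x : B, e x = a ∧ Closed x
    · obtain ⟨x, rfl, hx⟩ := ha
      let p : Fin (N.deg x) → G.neighborSet (e x) := fun i =>
        ⟨e ⟨N.nbr x i, hx i⟩, x, ⟨N.nbr x i, hx i⟩, N.adj_nbr x i, rfl, rfl⟩
      have hp : Function.Bijective p := by
        constructor
        · intro i i' h
          have h1 : N.nbr x i = N.nbr x i' :=
            congrArg (fun z : B => (z : Fin n)) (e.injective (Subtype.ext_iff.1 h))
          exact (N.port x).injective (Subtype.ext h1)
        · rintro ⟨b, x', y, hxy, hx', hy⟩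
          obtain rfl := e.injective hx'
          refine ⟨N.portTo x' y hxy, Subtype.ext ?_⟩
          exact (congrArg e (Subtype.ext (N.nbr_portTo hxy))).trans hy
      refine ⟨N.deg x, Equiv.ofBijective p hp, hdeg x, fun x' hx' _ => ?_⟩
      obtain rfl := e.injective hx'
      refine ⟨rfl, fun i i' hi h => ?_⟩
      obtain rfl := Fin.ext hi
      rfl
    · refine ⟨Nat.card (G.neighborSet a), (Finite.equivFin _).symm, ?_,
        fun x hx hc => absurd ⟨x, hx, hc⟩ ha⟩
      by_cases hr : ∃ x : B, e x = a
      · obtain ⟨x, rfl⟩ := hr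
        refine le_trans ?_ (hdeg x)
        have hex : ∀ b : G.neighborSet (e x), ∃ i : Fin (N.deg x), ∃ y : B, N.nbr x i = y ∧
            e y = b := by
          rintro ⟨b, x', y, hxy, hx', hy⟩
          obtain rfl := e.injective hx'
          exact ⟨N.portTo x' y hxy, y, N.nbr_portTo hxy, hy⟩
        choose g y hy hg using hex
        have hinj : Function.Injective g := by
          intro b b' hbb
          have : y b = y b' := Subtype.ext (by rw [← hy, ← hy, hbb])
          exact Subtype.ext (by rw [← hg, ← hg, this])
        simpa using Nat.card_le_card_of_injective g hinj
      · have : IsEmpty (G.neighborSet a) :=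
          ⟨fun ⟨b, x, y, _, hx, _⟩ => hr ⟨x, hx⟩⟩
        simp
  choose d p hd hp using hports
  let N' : Network m In :=
    { graph := G
      deg := d
      port := p
      input := fun a => if h : ∃ x : B, e x = a then N.input h.choose else N.input v }
  have hdegc : ∀ x : B, Closed x → N'.deg (e x) = N.deg x := fun x hx => (hp (e x) x rfl hx).1
  have hinput : ∀ x : B, N'.input (e x) = N.input x := by
    intro x
    have h : ∃ y : B, e y = e x := ⟨x, rfl⟩
    change (if h : ∃ y : B, e y = e x then N.input h.choose else N.input v) = _
    rw [dif_pos h, e.injective h.choose_spec]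
  have hclosed : ∀ x : B, N.Reach s v x → Closed x := fun x hx i =>
    Or.inl (hx.trans (reach_one_of_adj (N.adj_nbr x i)))
  refine ⟨N', B, e, Or.inl (Reach.refl N _ v), ?_, fun u hu => ⟨hdegc u (hclosed u hu), hinput u⟩,
    ?_⟩
  · refine le_antisymm (Finset.sup_le fun a _ => hd a) ?_
    have hB : u₀ ∈ B := Or.inr (Reach.refl N _ u₀)
    have hc : Closed ⟨u₀, hB⟩ := fun i => Or.inr (reach_one_of_adj (N.adj_nbr u₀ i))
    rw [← hu₀, ← hdegc ⟨u₀, hB⟩ hc]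
    exact N'.deg_le_maxDegree _
  · have key : ∀ (w : List ℕ) (x : B), (∀ u : B, N.Reach w.length x u → Closed u) →
        (N.walk x w = none ∧ N'.walk (e x) w = none) ∨
        ∃ y : B, N.walk x w = some (y : Fin n) ∧ N'.walk (e x) w = some (e y) := by
      intro w
      induction w with
      | nil => exact fun x _ => Or.inr ⟨x, rfl, rfl⟩
      | cons i w ih =>
        intro x hx
        have hc : Closed x := hx x (Reach.refl N _ _)
        have hdx := hdegc x hc
        by_cases hi : i < N.deg x
        · have hi' : i < N'.deg (e x) := by rwa [hdx]
          rw [walk_cons_of_lt _ _ _ _ hi, walk_cons_of_lt _ _ _ _ hi']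
          have hnbr : N'.nbr (e x) ⟨i, hi'⟩ = e ⟨N.nbr x ⟨i, hi⟩, hc _⟩ :=
            (hp (e x) x rfl hc).2 ⟨i, hi⟩ ⟨i, hi'⟩ rfl (hc _)
          rw [hnbr]
          refine ih ⟨N.nbr x ⟨i, hi⟩, hc _⟩ fun u hu => hx u ?_
          have := (reach_one_of_adj (N.adj_nbr x ⟨i, hi⟩)).trans hu
          exact this.mono (by simp; omega)
        · rw [walk_cons_of_not_lt _ _ _ _ hi, walk_cons_of_not_lt _ _ _ _ (by rwa [hdx])]
          exact Or.inl ⟨rfl, rfl⟩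
    intro w hw
    exact key w ⟨v, _⟩ fun u hu => hclosed u (hu.mono hw)

end Network

namespace Algorithm

variable {n r b : ℕ} {In Out : Type}

/-- Whether the output of `A` is acceptable around `v` depends only on the random bits near `v`. -/
theorem dependsOn_acceptsAt_run (A : Algorithm In Out r b) (P : LCL In Out) (N : Network n In)
    {s : ℕ} (hs : A.rounds + P.radius ≤ s) (v : Fin n) :
    DependsOn (fun σ : Fin n → Bits r => ¬ P.AcceptsAt N (A.run N σ) v) {u | N.Reach s v u} := by
  have h : ∀ σ σ' : Fin n → Bits r, (∀ u ∈ {u | N.Reach s v u}, σ u = σ' u) →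
      P.AcceptsAt N (A.run N σ) v → P.AcceptsAt N (A.run N σ') v := by
    intro σ σ' hσ
    refine A.acceptsAt_run_of_sameView (key := Fin.val) (key' := Fin.val) Fin.val_injective
      Fin.val_injective rfl ?_
    funext w
    unfold Network.gather
    split_ifs with hw
    · cases hu : N.walk v w with
      | none => rfl
      | some u =>
        rw [Option.map_some, Option.map_some, hσ u ⟨w, by omega, hu⟩]
    · rfl
  intro σ σ' hσ
  exact propext (not_congr ⟨h σ σ' hσ, h σ' σ fun u hu => (hσ u hu).symm⟩)

/-- An algorithm that is correct on all networks of size `m`, run on a network of any size, fails at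
a given vertex with probability at most `1 / m`. -/
theorem pr_not_acceptsAt_le (A : Algorithm In Out r b) (P : LCL In Out) {Δ m : ℕ} (hΔ : 2 ≤ Δ)
    (hA : A.SolvesWHP P Δ m) (N : Network n In) (hN : N.maxDegree = Δ) {s : ℕ}
    (hs : A.rounds + 1 + P.radius ≤ s) (hm : Δ ^ (s + 2) + Δ ^ 2 ≤ m) (v : Fin n) :
    pr (fun σ : Fin n → Bits r => ¬ P.AcceptsAt N (A.run N σ) v) ≤ 1 / (m : ℝ) := by
  classical
  obtain ⟨N', B, e, hv, hmax, hlab, hwalk⟩ := N.exists_embedded_ball hΔ hN v s hm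
  let key' : Fin m → ℕ := fun a => if h : ∃ x : B, e x = a then (h.choose : Fin n) else n + a
  have hkeye : ∀ x : B, key' (e x) = (x : Fin n) := by
    intro x
    have h : ∃ y : B, e y = e x := ⟨x, rfl⟩
    simp only [key', dif_pos h]
    rw [e.injective h.choose_spec]
  have hkey' : Function.Injective key' := by
    intro a a' haa
    by_cases h : ∃ x : B, e x = a <;> by_cases h' : ∃ x : B, e x = a'
    · obtain ⟨x, rfl⟩ := h
      obtain ⟨x', rfl⟩ := h'
      rw [hkeye, hkeye] at haa
      rw [Subtype.ext (Fin.ext haa)]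
    · simp only [key', dif_pos h, dif_neg h'] at haa
      omega
    · simp only [key', dif_pos h', dif_neg h] at haa
      omega
    · simp only [key', dif_neg h', dif_neg h] at haa
      exact Fin.ext (by omega)
  have hview : ∀ {M : Type} (X : Fin n → M) (X' : Fin m → M),
      (∀ u : B, N.Reach s v u → X u = X' (e u)) →
      Network.SameView N N' X X' s v (e ⟨v, hv⟩) := by
    intro M X X' hX
    funext w
    unfold Network.gather
    split_ifs with hw
    · rcases hwalk w hw with ⟨h1, h2⟩ | ⟨y, h1, h2⟩
      · rw [h1, h2]; rfl
      · rw [h1, h2, Option.map_some, Option.map_some, hX y ⟨w, hw, h1⟩]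
    · rfl
  have hbase : Network.SameBase N N' Fin.val key' s v (e ⟨v, hv⟩) := by
    refine hview _ _ fun u hu => ?_
    unfold Network.baseLabel
    rw [(hlab u hu).1, (hlab u hu).2, hkeye]
  let ext : (B → Bits r) → Fin n → Bits r := fun τ u =>
    if h : u ∈ B then τ ⟨u, h⟩ else fun _ => false
  let Q : (B → Bits r) → Prop := fun τ => ¬ P.AcceptsAt N (A.run N (ext τ)) v
  have hQ : (fun σ : Fin n → Bits r => ¬ P.AcceptsAt N (A.run N σ) v) =
      fun σ => Q (σ ∘ Subtype.val) := by
    funext σ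
    refine A.dependsOn_acceptsAt_run P N le_rfl v fun u hu => ?_
    have huB : u ∈ B := by
      obtain ⟨w, hw, hu⟩ := hu
      rcases hwalk w (by omega) with ⟨h1, -⟩ | ⟨y, h1, -⟩
      · rw [h1] at hu; simp at hu
      · rw [h1, Option.some.injEq] at hu
        exact hu ▸ y.2
    simp [ext, huB]
  have hfail : pr (fun σ' : Fin m → Bits r => ¬ P.Accepts N' (A.run N' σ')) ≤ 1 / (m : ℝ) :=
    hA N' hmax
  rw [hQ, pr_comp_injective Subtype.val_injective Q, ← pr_comp_injective e.injective Q]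
  have hsub : ∀ σ' : Fin m → Bits r, Q (σ' ∘ e) → ¬ P.Accepts N' (A.run N' σ') := by
    intro σ' hσ' hacc
    have hρ : Network.SameView N N' (ext (σ' ∘ e)) σ' s v (e ⟨v, hv⟩) := by
      refine hview _ _ fun u _ => ?_
      simp only [ext, dif_pos u.2]
      rfl
    exact hσ' (A.acceptsAt_run_of_sameView hkey' Fin.val_injective (hbase.symm.mono hs)
      (hρ.symm.mono (by omega)) (hacc (e ⟨v, hv⟩)))
  exact (pr_mono hsub).trans hfail

end Algorithm

/-! ### Labelings computable by message passing -/

/-- On all networks and random bits with `Q`, the labeling `X` is computed by an algorithm in `T`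
rounds with `b`-bit messages. -/
def Computes {n r : ℕ} {In S : Type} (Q : Network n In → (Fin n → Bits r) → Prop) (T b : ℕ)
    (X : Network n In → (Fin n → Bits r) → Fin n → S) : Prop :=
  ∃ A : Algorithm In S r b, A.rounds = T ∧ ∀ N ρ, Q N ρ → ∀ v, A.run N ρ v = X N ρ v

section Computes

variable {n r T b : ℕ} {In S S' : Type} {Q : Network n In → (Fin n → Bits r) → Prop}
  {X : Network n In → (Fin n → Bits r) → Fin n → S}

theorem computes_init (f : ℕ → In → Bits r → S) :
    Computes (n := n) Q 0 b fun N ρ v => f (N.deg v) (N.input v) (ρ v) :=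
  ⟨{  rounds := 0
      State := fun _ => S
      init := f
      send := fun _ _ _ _ => false
      receive := fun _ s _ => s
      output := fun _ s => s }, rfl, fun _ _ _ _ => rfl⟩

theorem Computes.map_deg (h : Computes Q T b X) (g : ℕ → S → S') :
    Computes Q T b fun N ρ v => g (N.deg v) (X N ρ v) := by
  obtain ⟨A, hT, hA⟩ := h
  let A' : Algorithm In S' r b :=
    { rounds := A.rounds
      State := A.State
      init := A.init
      send := A.send
      receive := A.receive
      output := fun d s => g d (A.output d s) }
  have hst : ∀ N ρ t v, A'.stateAt N ρ t v = A.stateAt (n := n) N ρ t v := by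
    intro N ρ t
    induction t with
    | zero => exact fun v => rfl
    | succ t ih =>
      intro v
      rw [Algorithm.stateAt, Algorithm.stateAt]
      simp only [ih]
      rfl
  refine ⟨A', hT, fun N ρ hQ v => ?_⟩
  change g _ (A.output _ (A'.stateAt N ρ A.rounds v)) = _
  rw [hst]
  exact congrArg (g _) (hA N ρ hQ v)

theorem Computes.map (h : Computes Q T b X) (g : S → S') :
    Computes Q T b fun N ρ v => g (X N ρ v) :=
  h.map_deg fun _ => g

theorem Computes.nonempty [Nonempty In] (h : Computes Q T b X) : Nonempty S := by
  obtain ⟨A, -, -⟩ := h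
  exact ⟨A.output 0 (A.init 0 (Classical.arbitrary In) fun _ => false)⟩

theorem Computes.congr {X' : Network n In → (Fin n → Bits r) → Fin n → S} (h : Computes Q T b X)
    (hX : ∀ N ρ, Q N ρ → ∀ v, X N ρ v = X' N ρ v) : Computes Q T b X' := by
  obtain ⟨A, hT, hA⟩ := h
  exact ⟨A, hT, fun N ρ hQ v => (hA N ρ hQ v).trans (hX N ρ hQ v)⟩

/-- Local computation is free: a labeling that is determined by a computable one is computable. -/
theorem Computes.of_determined [Nonempty S'] {Y : Network n In → (Fin n → Bits r) → Fin n → S'}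
    (h : Computes Q T b X)
    (hY : ∀ N ρ v N' ρ' v', Q N ρ → Q N' ρ' → X N ρ v = X N' ρ' v' → Y N ρ v = Y N' ρ' v') :
    Computes Q T b Y := by
  classical
  let g : S → S' := fun s =>
    if h : ∃ z : Network n In × (Fin n → Bits r) × Fin n, Q z.1 z.2.1 ∧ X z.1 z.2.1 z.2.2 = s then
      Y h.choose.1 h.choose.2.1 h.choose.2.2 else Classical.arbitrary S'
  refine (h.map g).congr fun N ρ hQ v => ?_
  have hex : ∃ z : Network n In × (Fin n → Bits r) × Fin n,
      Q z.1 z.2.1 ∧ X z.1 z.2.1 z.2.2 = X N ρ v := ⟨(N, ρ, v), hQ, rfl⟩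
  simp only [g, dif_pos hex]
  exact hY _ _ _ _ _ _ hex.choose_spec.1 hQ hex.choose_spec.2

theorem Computes.round (h : Computes Q T b X) (send : S → ℕ → Bits b) :
    Computes Q (T + 1) b fun N ρ v => (X N ρ v, N.inbox (fun u => send (X N ρ u)) v) := by
  obtain ⟨A, rfl, hA⟩ := h
  let A' : Algorithm In (S × (ℕ → Option (Bits b))) r b :=
    { rounds := A.rounds + 1
      State := fun d => ℕ × A.State d × (ℕ → Option (Bits b))
      init := fun d x β => (0, A.init d x β, fun _ => none)
      send := fun d s i => if s.1 < A.rounds then A.send d s.2.1 i else send (A.output d s.2.1) i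
      receive := fun d s f => (s.1 + 1, if s.1 < A.rounds then (A.receive d s.2.1 f, fun _ => none)
        else (s.2.1, fun i => if h : i < d then some (f ⟨i, h⟩) else none))
      output := fun d s => (A.output d s.2.1, s.2.2) }
  have hst : ∀ N ρ t, t ≤ A.rounds → ∀ v : Fin n,
      A'.stateAt N ρ t v = (t, A.stateAt N ρ t v, fun _ => none) := by
    intro N ρ t
    induction t with
    | zero => exact fun _ v => rfl
    | succ t ih =>
      intro ht v
      have hlt : t < A.rounds := by omega
      rw [Algorithm.stateAt, Algorithm.stateAt]
      simp only [ih hlt.le]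
      simp only [A', if_pos hlt]
  refine ⟨A', rfl, fun N ρ hQ v => ?_⟩
  change A'.output _ (A'.stateAt N ρ (A.rounds + 1) v) = _
  rw [Algorithm.stateAt]
  simp only [hst N ρ A.rounds le_rfl]
  simp only [A', lt_irrefl, if_false]
  have hX : ∀ u, A.output (N.deg u) (A.stateAt N ρ A.rounds u) = X N ρ u := hA N ρ hQ
  simp only [hX]
  rfl

/-- A long message is sent in `L` pieces of `b` bits. -/
theorem Computes.stream {M : Type} (h : Computes Q T b X) (send : S → ℕ → M) (enc : M → ℕ → Bool)
    (L : ℕ) : Computes Q (T + L) b fun N ρ v => (X N ρ v, fun i =>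
      (N.inbox (fun u => send (X N ρ u)) v i).map
        fun m k => if k < L * b then enc m k else false) := by
  induction L with
  | zero =>
    refine (h.map_deg fun d x => (x, fun i => if i < d then some fun _ => false else none)).congr
      fun N ρ _ v => Prod.ext rfl (funext fun i => ?_)
    by_cases hi : i < N.deg v
    · simp [Network.inbox, hi]
    · simp [Network.inbox, hi]
  | succ L ih =>
    have h1 := (ih.round fun s i j => enc (send s.1 i) (L * b + j)).map
      fun s => (s.1.1, fun i => (s.1.2 i).map fun p k =>
        if k < L * b then p k else if h : k - L * b < b then
          ((s.2 i).getD fun _ => false) ⟨k - L * b, h⟩ else false)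
    refine h1.congr fun N ρ _ v => ?_
    refine Prod.ext rfl (funext fun i => ?_)
    dsimp only
    by_cases hi : i < N.deg v
    · simp only [Network.inbox, dif_pos hi, Option.map_some, Option.getD_some]
      congr 1
      funext k
      rw [Nat.succ_mul]
      by_cases hk : k < L * b
      · rw [if_pos hk, if_pos hk, if_pos (by omega)]
      · rw [if_neg hk]
        by_cases hk' : k - L * b < b
        · rw [dif_pos hk', if_pos (by omega)]
          congr 1
          omega
        · rw [dif_neg hk', if_neg (by omega)]
    · simp only [Network.inbox, dif_neg hi, Option.map_none]

/-- All vertices send messages from a finite set that is small enough for `L` rounds. -/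
theorem Computes.exchange [Nonempty In] {M : Type} (h : Computes Q T b X)
    (send : S → ℕ → M) (Z : Set M)
    (hfin : Z.Finite) (L : ℕ) (hcard : Z.ncard ≤ 2 ^ (L * b))
    (hZ : ∀ N ρ, Q N ρ → ∀ u i, i < N.deg u → send (X N ρ u) i ∈ Z) :
    Computes Q (T + L) b fun N ρ v => (X N ρ v, N.inbox (fun u => send (X N ρ u)) v) := by
  classical
  have := hfin.fintype
  obtain ⟨f⟩ : Nonempty (Z ↪ Bits (L * b)) := by
    refine Function.Embedding.nonempty_of_card_le ?_
    rw [← Nat.card_eq_fintype_card]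
    simpa using hcard
  let enc : M → ℕ → Bool := fun m k =>
    if h : m ∈ Z ∧ k < L * b then f ⟨m, h.1⟩ ⟨k, h.2⟩ else false
  have henc : ∀ m ∈ Z, ∀ m' ∈ Z, (fun k => if k < L * b then enc m k else false) =
      (fun k => if k < L * b then enc m' k else false) → m = m' := by
    intro m hm m' hm' he
    refine congrArg Subtype.val (f.injective (a₁ := ⟨m, hm⟩) (a₂ := ⟨m', hm'⟩) (funext fun k => ?_))
    have := congrFun he k
    simpa [enc, hm, hm'] using this
  have hS := h.nonempty
  refine (h.stream send enc L).of_determined ?_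
  intro N ρ v N' ρ' v' hQ hQ' heq
  obtain ⟨h1, h2⟩ := Prod.ext_iff.1 heq
  refine Prod.ext h1 (funext fun i => ?_)
  have h3 := congrFun h2 i
  dsimp only at h3 ⊢
  unfold Network.inbox at h3 ⊢
  by_cases hi : i < N.deg v <;> by_cases hi' : i < N'.deg v'
  · rw [dif_pos hi, dif_pos hi', Option.map_some, Option.map_some, Option.some.injEq] at h3
    rw [dif_pos hi, dif_pos hi']
    congr 1
    exact henc _ (hZ N ρ hQ _ _ (Fin.is_lt _)) _ (hZ N' ρ' hQ' _ _ (Fin.is_lt _)) h3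
  · rw [dif_pos hi, dif_neg hi'] at h3
    simp at h3
  · rw [dif_neg hi, dif_pos hi'] at h3
    simp at h3
  · rw [dif_neg hi, dif_neg hi']

/-- The port lists of length at most `j` that can occur in a network of maximum degree `Δ`. -/
def portWords (Δ : ℕ) : ℕ → Finset (List ℕ)
  | 0 => {[]}
  | j + 1 => insert [] ((Finset.range Δ ×ˢ portWords Δ j).image fun p => p.1 :: p.2)

theorem card_portWords_lt {Δ : ℕ} (hΔ : 2 ≤ Δ) (j : ℕ) : (portWords Δ j).card < Δ ^ (j + 1) := by
  induction j with
  | zero => simp [portWords]; omega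
  | succ j ih =>
    have h1 : (portWords Δ (j + 1)).card ≤ Δ * (portWords Δ j).card + 1 := by
      refine (Finset.card_insert_le _ _).trans (Nat.add_le_add_right ?_ 1)
      refine Finset.card_image_le.trans ?_
      rw [Finset.card_product, Finset.card_range]
    calc (portWords Δ (j + 1)).card ≤ Δ * (portWords Δ j).card + 1 := h1
      _ < Δ * ((portWords Δ j).card + 1) := by rw [mul_add]; omega
      _ ≤ Δ * Δ ^ (j + 1) := Nat.mul_le_mul_left _ ih
      _ = Δ ^ (j + 1 + 1) := (pow_succ' _ _).symm

theorem mem_portWords_of_walk {N : Network n In} {Δ : ℕ} (hN : ∀ v, N.deg v ≤ Δ) {v u : Fin n}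
    {w : List ℕ} (h : N.walk v w = some u) {j : ℕ} (hw : w.length ≤ j) : w ∈ portWords Δ j := by
  induction j generalizing v w with
  | zero => simp [portWords, List.length_eq_zero_iff.1 (Nat.le_zero.1 hw)]
  | succ j ih =>
    obtain _ | ⟨i, w⟩ := w
    · simp [portWords]
    · by_cases hi : i < N.deg v
      · rw [N.walk_cons_of_lt _ _ _ hi] at h
        refine Finset.mem_insert_of_mem (Finset.mem_image.2 ⟨(i, w), ?_, rfl⟩)
        exact Finset.mem_product.2 ⟨Finset.mem_range.2 (hi.trans_le (hN v)),
          ih h (by simpa using hw)⟩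
      · rw [N.walk_cons_of_not_lt _ _ _ hi] at h
        simp at h

/-- The possible views of radius `j` with labels in `Z`. -/
def viewSet {M : Type} (Δ : ℕ) (Z : Set M) (j : ℕ) : Set (List ℕ → Option M) :=
  {g | ∀ w m, g w = some m → w ∈ portWords Δ j ∧ m ∈ Z}

theorem finite_viewSet {M : Type} {Δ : ℕ} (hΔ : 2 ≤ Δ) {Z : Set M} (hZ : Z.Finite) {q : ℕ}
    (hq : Z.ncard ≤ 2 ^ q) (j : ℕ) :
    (viewSet Δ Z j).Finite ∧ (viewSet Δ Z j).ncard ≤ 2 ^ ((q + 1) * Δ ^ (j + 1)) := by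
  classical
  have := hZ.fintype
  let f : viewSet Δ Z j → (portWords Δ j → Option Z) := fun g w =>
    (g.1 w).bind fun m => if h : m ∈ Z then some ⟨m, h⟩ else none
  have hf : ∀ (g : viewSet Δ Z j) (w : portWords Δ j), (f g w).map Subtype.val = g.1 w := by
    intro g w
    simp only [f]
    cases h : g.1 w with
    | none => rfl
    | some m => simp [(g.2 w m h).2]
  have hinj : Function.Injective f := by
    intro g g' hgg
    refine Subtype.ext (funext fun w => ?_)
    by_cases hw : w ∈ portWords Δ j
    · rw [← hf g ⟨w, hw⟩, ← hf g' ⟨w, hw⟩, hgg]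
    · have h0 : ∀ g : viewSet Δ Z j, g.1 w = none := fun g =>
        Option.eq_none_iff_forall_ne_some.2 fun m hm => hw (g.2 w m hm).1
      rw [h0, h0]
  have hfin : Finite (viewSet Δ Z j) := Finite.of_injective f hinj
  refine ⟨hfin, ?_⟩
  have hZc : Fintype.card (Option Z) ≤ 2 ^ (q + 1) := by
    rw [Fintype.card_option, ← Nat.card_eq_fintype_card]
    have h1 : Nat.card Z ≤ 2 ^ q := hq
    have h2 : 1 ≤ 2 ^ q := Nat.one_le_two_pow
    rw [pow_succ]
    omega
  calc (viewSet Δ Z j).ncard ≤ Nat.card (portWords Δ j → Option Z) :=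
        Nat.card_le_card_of_injective f hinj
    _ = Fintype.card (Option Z) ^ (portWords Δ j).card := by
        rw [Nat.card_eq_fintype_card, Fintype.card_fun, Fintype.card_coe]
    _ ≤ (2 ^ (q + 1)) ^ Δ ^ (j + 1) :=
        (Nat.pow_le_pow_left hZc _).trans
          (Nat.pow_le_pow_right (by positivity) (card_portWords_lt hΔ j).le)
    _ = 2 ^ ((q + 1) * Δ ^ (j + 1)) := (pow_mul _ _ _).symm

/-- Gathering the labels within distance `J`: `L` rounds for each unit of distance are enough if a
view fits into `L` messages. -/
theorem Computes.gather [Nonempty In] {M : Type} {Δ : ℕ} (hΔ : 2 ≤ Δ)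
    (hdeg : ∀ N ρ, Q N ρ → ∀ v, N.deg v ≤ Δ) (h : Computes Q T b X) (g : S → M) (Z : Set M)
    (hfin : Z.Finite) {q : ℕ} (hq : Z.ncard ≤ 2 ^ q)
    (hZ : ∀ N ρ, Q N ρ → ∀ v, g (X N ρ v) ∈ Z) (L J : ℕ) (hL : (q + 1) * Δ ^ J ≤ L * b) :
    Computes Q (T + J * L) b fun N ρ v => (X N ρ v, N.gather (fun u => g (X N ρ u)) J v) := by
  suffices h : ∀ j ≤ J, Computes Q (T + j * L) b
      fun N ρ v => (X N ρ v, N.gather (fun u => g (X N ρ u)) j v) from h J le_rfl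
  intro j
  induction j with
  | zero =>
    intro _
    rw [Nat.zero_mul]
    refine (h.map fun x => (x, fun w : List ℕ => if w.length ≤ 0 then some (g x) else none)).congr
      fun N ρ _ v => Prod.ext rfl (funext fun w => ?_)
    obtain _ | ⟨i, w⟩ := w
    · rfl
    · simp [Network.gather]
  | succ j ih =>
    intro hj
    have hview := finite_viewSet hΔ hfin hq j
    have h1 := ((ih (by omega)).exchange (fun x _ => x.2) (viewSet Δ Z j) hview.1 L
      (hview.2.trans (Nat.pow_le_pow_right (by omega) (le_trans (Nat.mul_le_mul_left _
        (Nat.pow_le_pow_right (by omega) hj)) hL))) (by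
          intro N ρ hQ u i _ w m hm
          simp only [Network.gather] at hm
          split_ifs at hm with hw
          · obtain ⟨x, hx, rfl⟩ := Option.map_eq_some_iff.1 hm
            exact ⟨mem_portWords_of_walk (hdeg N ρ hQ) hx hw, hZ N ρ hQ x⟩)).map
      fun s => (s.1.1, fun w : List ℕ => match w with
        | [] => some (g s.1.1)
        | i :: w => (s.2 i).bind fun f => f w)
    rw [Nat.succ_mul, ← add_assoc]
    refine h1.congr fun N ρ _ v => Prod.ext rfl (funext fun w => ?_)
    obtain _ | ⟨i, w⟩ := w
    · rfl
    · by_cases hi : i < N.deg v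
      · simp [Network.inbox, Network.gather, hi, N.walk_cons_of_lt v i w hi]
      · simp [Network.inbox, Network.gather, hi, N.walk_cons_of_not_lt v i w hi]

end Computes

/-! ### The resampling algorithm -/

section ResamplingAlgorithm

variable {n r r' m b : ℕ} {In Out S : Type}

theorem acceptsAt_iff_of_sameView {P : LCL In Out} {N N' : Network n In} {κ κ' : Fin n → ℕ}
    (hκ : Function.Injective κ) (hκ' : Function.Injective κ') {out out' : Fin n → Out}
    {v v' : Fin n} (h : Network.SameBase N N' κ κ' (P.radius + 1) v v')
    (hout : Network.SameView N N' out out' P.radius v v') :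
    P.AcceptsAt N out v ↔ P.AcceptsAt N' out' v' :=
  ⟨Network.SameView.acceptsAt hκ hκ' h hout,
    Network.SameView.acceptsAt hκ' hκ h.symm hout.symm⟩

theorem Network.SameView.reach_iff {M : Type*} {N N' : Network n In} {X X' : Fin n → M} {j : ℕ}
    {v v' : Fin n} (h : Network.SameView N N' X X' j v v') {p : M → Prop} :
    (∃ u, N.Reach j v u ∧ p (X u)) ↔ ∃ u, N'.Reach j v' u ∧ p (X' u) := by
  have key : ∀ {N N' : Network n In} {X X' : Fin n → M} {v v' : Fin n},
      Network.SameView N N' X X' j v v' → (∃ u, N.Reach j v u ∧ p (X u)) →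
      ∃ u, N'.Reach j v' u ∧ p (X' u) := by
    rintro N N' X X' v v' h ⟨u, ⟨w, hw, hu⟩, hp⟩
    obtain ⟨u', hu', hs⟩ := h.of_walk hw hu
    exact ⟨u', ⟨w, hw, hu'⟩, hs.apply_eq ▸ hp⟩
  exact ⟨key h, key h.symm⟩

theorem Network.SameView.prod {M M' : Type*} {N N' : Network n In} {X X' : Fin n → M}
    {Z Z' : Fin n → M'} {j : ℕ} {v v' : Fin n} (h : Network.SameView N N' X X' j v v')
    (h' : Network.SameView N N' Z Z' j v v') :
    Network.SameView N N' (fun u => (X u, Z u)) (fun u => (X' u, Z' u)) j v v' := by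
  funext w
  have h1 := congrFun h w
  have h2 := congrFun h' w
  unfold Network.gather at h1 h2 ⊢
  split_ifs at h1 h2 ⊢
  · cases hx : N.walk v w <;> cases hx' : N'.walk v' w <;> simp_all
  · rfl

/-- Whether a vertex is selected is determined by the names and the occurring events in its view. -/
theorem selected_iff_of_sameView {N N' : Network n In} {κ κ' : Fin n → ℕ} {J s : ℕ}
    {viol viol' : Fin n → (Fin n → Bits r) → Prop} {σ σ' : Fin n → Bits r} {v v' : Fin n}
    (h : Network.SameBase N N' κ κ' J v v') (hJ : 2 * s ≤ J)
    (hv : Network.SameView N N' (fun u => viol u σ) (fun u => viol' u σ') (2 * s) v v') :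
    Selected viol (N.Reach (2 * s)) κ σ v ↔ Selected viol' (N'.Reach (2 * s)) κ' σ' v' := by
  have h1 := ((h.mono hJ).prod hv).reach_iff (p := fun x => x.2 ∧ x.1.2.1 < κ v)
  have h2 : viol v σ = viol' v' σ' := hv.apply_eq
  have h3 : κ v = κ' v' := h.key_eq
  have h4 : ∀ {N : Network n In} {κ : Fin n → ℕ} {viol : Fin n → (Fin n → Bits r) → Prop}
      {σ : Fin n → Bits r} {v : Fin n}, Selected viol (N.Reach (2 * s)) κ σ v ↔
      viol v σ ∧ ¬ ∃ u, N.Reach (2 * s) v u ∧ viol u σ ∧ κ u < κ v := by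
    intro N κ viol σ v
    unfold Selected
    refine and_congr_right fun _ => ?_
    push Not
    exact forall_congr' fun u => ⟨fun h hr hv => h hv hr, fun h hv hr => h hr hv⟩
  rw [h4, h4, ← h2, ← h3]
  exact and_congr_right fun _ => not_congr h1

/-- Every vertex knows its view of radius `J`, where the vertices are named by `key`. -/
def KnowsBase (Q : Network n In → (Fin n → Bits r') → Prop) (key : Bits r' → ℕ) (J : ℕ)
    (Y : Network n In → (Fin n → Bits r') → Fin n → S) : Prop :=
  ∀ N ρ v N' ρ' v', Q N ρ → Q N' ρ' → Y N ρ v = Y N' ρ' v' →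
    Network.SameBase N N' (fun u => key (ρ u)) (fun u => key (ρ' u)) J v v'

/-- If the vertices know their views and hold random bits `σ` for `A`, then in `τ` rounds they can
compute the output of `A` with the random bits `σ` and whether it is acceptable around them. -/
def Evaluable (Q : Network n In → (Fin n → Bits r') → Prop) (key : Bits r' → ℕ) (J : ℕ)
    (A : Algorithm In Out r m) (P : LCL In Out) (τ b : ℕ) : Prop :=
  ∀ {S : Type} (T : ℕ) (Y : Network n In → (Fin n → Bits r') → Fin n → S) (σ : S → Bits r),
    Computes Q T b Y → KnowsBase Q key J Y →
    Computes Q (T + τ) b fun N ρ v => (Y N ρ v,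
      ¬ P.AcceptsAt N (A.run N fun u => σ (Y N ρ u)) v, A.run N (fun u => σ (Y N ρ u)) v)

variable {Q : Network n In → (Fin n → Bits r') → Prop} {key : Bits r' → ℕ} {Δ J : ℕ}
  [Nonempty In]

/-- Evaluation by gathering the random bits of all vertices that influence the result. -/
theorem evaluable_of_gather_bits (hΔ : 2 ≤ Δ) (hdeg : ∀ N ρ, Q N ρ → ∀ v, N.deg v ≤ Δ)
    (hkey : ∀ N ρ, Q N ρ → Function.Injective fun u => key (ρ u)) (A : Algorithm In Out r m)
    (P : LCL In Out) (hJ : A.rounds + 1 + P.radius ≤ J)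
    (hb : (r + 1) * Δ ^ (A.rounds + P.radius) ≤ b) :
    Evaluable Q key J A P (A.rounds + P.radius) b := by
  intro S T Y σ hY hK
  have hS := hY.nonempty
  have : Nonempty Out := ⟨A.output 0 (A.init 0 (Classical.arbitrary In) fun _ => false)⟩
  have h1 := hY.gather hΔ hdeg σ Set.univ Set.finite_univ (q := r) (by simp [Set.ncard_univ])
    (fun _ _ _ _ => Set.mem_univ _) 1 (A.rounds + P.radius) (by simpa using hb)
  rw [Nat.mul_one] at h1
  refine h1.of_determined fun N ρ v N' ρ' v' hQ hQ' heq => ?_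
  obtain ⟨h2, h3⟩ := Prod.ext_iff.1 heq
  have hbase := hK N ρ v N' ρ' v' hQ hQ' h2
  have hσ : Network.SameView N N' (fun u => σ (Y N ρ u)) (fun u => σ (Y N' ρ' u))
    (A.rounds + P.radius) v v' := h3
  have hrun := A.sameView_run (R := P.radius) (hkey N' ρ' hQ') (hbase.mono hJ) hσ
  rw [Prod.mk.injEq, Prod.mk.injEq]
  exact ⟨h2, propext (not_congr (acceptsAt_iff_of_sameView (hkey N ρ hQ) (hkey N' ρ' hQ')
    (hbase.mono (by omega)) hrun)), hrun.apply_eq⟩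

theorem Computes.sigmaState (A : Algorithm In Out r m) (hm : m ≤ b) {T : ℕ}
    {Y : Network n In → (Fin n → Bits r') → Fin n → S} (hY : Computes Q T b Y) (σ : S → Bits r)
    (inp : S → In) (hinp : ∀ N ρ, Q N ρ → ∀ v, inp (Y N ρ v) = N.input v) (t : ℕ) :
    Computes Q (T + t) b fun N ρ v => (Y N ρ v, A.sigmaState N (fun u => σ (Y N ρ u)) t v) := by
  induction t with
  | zero =>
    refine (hY.map_deg fun d y => (y, (⟨d, A.init d (inp y) (σ y)⟩ : Σ d, A.State d))).congr
      fun N ρ hQ v => ?_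
    rw [hinp N ρ hQ]
    rfl
  | succ t ih =>
    refine ((ih.exchange (fun y => A.sigmaSend y.2) Set.univ Set.finite_univ 1 ?_
      fun _ _ _ _ _ _ => Set.mem_univ _).map fun y => (y.1.1, A.sigmaReceive y.1.2 y.2)).congr
      fun N ρ _ v => ?_
    · simpa [Set.ncard_univ] using Nat.pow_le_pow_right (by omega) hm
    · rw [A.sigmaState_succ]

/-- Evaluation by simulating `A` and gathering the outputs. -/
theorem evaluable_of_simulation (hΔ : 2 ≤ Δ) (hdeg : ∀ N ρ, Q N ρ → ∀ v, N.deg v ≤ Δ)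
    (hkey : ∀ N ρ, Q N ρ → Function.Injective fun u => key (ρ u)) (A : Algorithm In Out r m)
    (P : LCL In Out) (hJ : P.radius + 1 ≤ J) (hm : m ≤ b) [Finite Out] {q : ℕ}
    (hq : Nat.card Out ≤ 2 ^ q) (hb : (q + 1) * Δ ^ P.radius ≤ b) :
    Evaluable Q key J A P (A.rounds + P.radius) b := by
  intro S T Y σ hY hK
  have hS := hY.nonempty
  have : Nonempty Out := ⟨A.output 0 (A.init 0 (Classical.arbitrary In) fun _ => false)⟩
  have h0 : Computes Q T b fun N ρ v => (Y N ρ v, N.input v) :=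
    hY.of_determined fun N ρ v N' ρ' v' hQ hQ' h =>
      Prod.ext h (hK N ρ v N' ρ' v' hQ hQ' h).input_eq
  have h1 := (h0.sigmaState A hm (fun y => σ y.1) (fun y => y.2) (fun _ _ _ _ => rfl) A.rounds).map
    fun y => (y.1.1, A.output y.2.1 y.2.2)
  have h2 : Computes Q (T + A.rounds) b
      fun N ρ v => (Y N ρ v, A.run N (fun u => σ (Y N ρ u)) v) := h1
  have h3 := h2.gather hΔ hdeg (fun y => y.2) Set.univ Set.finite_univ (q := q)
    (by simpa [Set.ncard_univ] using hq) (fun _ _ _ _ => Set.mem_univ _) 1 P.radius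
    (by simpa using hb)
  rw [Nat.mul_one, add_assoc] at h3
  refine h3.of_determined fun N ρ v N' ρ' v' hQ hQ' heq => ?_
  obtain ⟨h4, h5⟩ := Prod.ext_iff.1 heq
  obtain ⟨h6, h7⟩ := Prod.ext_iff.1 h4
  have hbase := hK N ρ v N' ρ' v' hQ hQ' h6
  have hout : Network.SameView N N' (A.run N fun u => σ (Y N ρ u))
    (A.run N' fun u => σ (Y N' ρ' u)) P.radius v v' := h5
  rw [Prod.mk.injEq, Prod.mk.injEq]
  exact ⟨h6, propext (not_congr (acceptsAt_iff_of_sameView (hkey N ρ hQ) (hkey N' ρ' hQ')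
    (hbase.mono hJ) hout)), h7⟩

/-- The event that the output of `A` is not acceptable around a vertex. -/
def NotAccepted (A : Algorithm In Out r m) (P : LCL In Out) (N : Network n In) (v : Fin n)
    (σ : Fin n → Bits r) : Prop := ¬ P.AcceptsAt N (A.run N σ) v

/-- The number of resamplings of the vertices in `i` steps, for the events `NotAccepted` on the
variables within distance `s`. -/
noncomputable def resamplings (A : Algorithm In Out r m) (P : LCL In Out) (key : Bits r' → ℕ)
    (y : Bits r' → ℕ → Bits r) (s : ℕ) (N : Network n In) (ρ : Fin n → Bits r') (i : ℕ) :
    Fin n → ℕ :=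
  resampleCount (NotAccepted A P N) (N.Reach (2 * s)) (fun u => key (ρ u))
    (fun v => {u | N.Reach s v u}) (fun u => y (ρ u)) i

/-- The resampling steps: in each step, the vertices evaluate `A`, gather the occurring events in
order to find out who is selected, and gather the selected vertices. -/
theorem computes_resamplings (hΔ : 2 ≤ Δ) (hdeg : ∀ N ρ, Q N ρ → ∀ v, N.deg v ≤ Δ)
    (A : Algorithm In Out r m) (P : LCL In Out) {τ s T : ℕ} (hJ : 2 * s ≤ J)
    (hev : Evaluable Q key J A P τ b) (hb : 2 * Δ ^ (2 * s) ≤ b) (y : Bits r' → ℕ → Bits r)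
    (h0 : Computes Q T b fun N ρ v => (ρ v, N.gather (N.baseLabel fun u => key (ρ u)) J v))
    (i : ℕ) :
    Computes Q (T + i * (τ + 3 * s)) b fun N ρ v =>
      ((ρ v, N.gather (N.baseLabel fun u => key (ρ u)) J v), resamplings A P key y s N ρ i v) := by
  classical
  have hs : ∀ {j}, j ≤ 2 * s → (1 + 1) * Δ ^ j ≤ 1 * b := fun hj => by
    rw [one_mul]
    exact (Nat.mul_le_mul_left _ (Nat.pow_le_pow_right (by omega) hj)).trans hb
  have hprop : (Set.univ : Set Prop).ncard ≤ 2 ^ 1 := by simp [Set.ncard_univ]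
  induction i with
  | zero =>
    rw [Nat.zero_mul]
    exact h0.map fun x => (x, 0)
  | succ i ih =>
    let Y := fun (N : Network n In) (ρ : Fin n → Bits r') (v : Fin n) =>
      ((ρ v, N.gather (N.baseLabel fun u => key (ρ u)) J v), resamplings A P key y s N ρ i v)
    let σ := fun (N : Network n In) (ρ : Fin n → Bits r') (v : Fin n) =>
      y (ρ v) (resamplings A P key y s N ρ i v)
    have hK : KnowsBase Q key J Y := fun N ρ v N' ρ' v' _ _ h =>
      (Prod.ext_iff.1 (Prod.ext_iff.1 h).1).2
    have h1 : Computes Q (T + i * (τ + 3 * s) + τ) b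
        fun N ρ v => (Y N ρ v, NotAccepted A P N v (σ N ρ)) :=
      (hev _ Y (fun x => y x.1.1 x.2) ih hK).map fun x => (x.1, x.2.1)
    have h2 := h1.gather hΔ hdeg (fun x => x.2) Set.univ Set.finite_univ hprop
      (fun _ _ _ _ => Set.mem_univ _) 1 (2 * s) (hs le_rfl)
    have hS := h2.nonempty
    have h3 : Computes Q (T + i * (τ + 3 * s) + τ + 2 * s * 1) b fun N ρ v => (Y N ρ v,
        Selected (NotAccepted A P N) (N.Reach (2 * s)) (fun u => key (ρ u)) (σ N ρ) v) := by
      have := ih.nonempty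
      refine h2.of_determined fun N ρ v N' ρ' v' hQ hQ' heq => ?_
      obtain ⟨h4, h5⟩ := Prod.ext_iff.1 heq
      have h6 := (Prod.ext_iff.1 h4).1
      exact Prod.ext h6 (propext (selected_iff_of_sameView (hK N ρ v N' ρ' v' hQ hQ' h6) hJ h5))
    have h4 := h3.gather hΔ hdeg (fun x => x.2) Set.univ Set.finite_univ hprop
      (fun _ _ _ _ => Set.mem_univ _) 1 s (hs (by omega))
    have hT : T + (i + 1) * (τ + 3 * s) = T + i * (τ + 3 * s) + τ + 2 * s * 1 + s * 1 := by ring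
    rw [hT]
    have := ih.nonempty
    refine h4.of_determined fun N ρ v N' ρ' v' hQ hQ' heq => ?_
    obtain ⟨h5, h6⟩ := Prod.ext_iff.1 heq
    obtain ⟨h7, h8⟩ := Prod.ext_iff.1 (Prod.ext_iff.1 h5).1
    refine Prod.ext h7 ?_
    have h9 : ∀ (N : Network n In) (ρ : Fin n → Bits r') (v : Fin n),
        (∃ e, Selected (NotAccepted A P N) (N.Reach (2 * s)) (fun u => key (ρ u)) (σ N ρ) e ∧
          v ∈ {u | N.Reach s e u}) ↔ ∃ e, N.Reach s v e ∧
          Selected (NotAccepted A P N) (N.Reach (2 * s)) (fun u => key (ρ u)) (σ N ρ) e :=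
      fun N ρ v => exists_congr fun e =>
        ⟨fun h => ⟨Network.Reach.symm h.2, h.1⟩, fun h => ⟨h.2, Network.Reach.symm h.1⟩⟩
    have h10 := (Network.SameView.reach_iff (N := N) (N' := N') (p := fun x => x) h6)
    have h11 := (h9 N ρ v).trans (h10.trans (h9 N' ρ' v').symm)
    have h12 : resamplings A P key y s N ρ i v = resamplings A P key y s N' ρ' i v' := h8
    change resampleCount _ _ _ _ _ (i + 1) v = resampleCount _ _ _ _ _ (i + 1) v'
    rw [resampleCount_succ, resampleCount_succ]
    refine congrArg₂ (· + ·) h12 ?_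
    split_ifs with ha hb hb
    exacts [rfl, absurd (h11.1 ha) hb, absurd (h11.2 hb) ha, rfl]

/-- The whole algorithm: the vertices gather their views, perform `k` resampling steps, and evaluate
`A` a last time. -/
theorem exists_resampling_algorithm [Fintype In] (hΔ : 2 ≤ Δ)
    (hdeg : ∀ N ρ, Q N ρ → ∀ v, N.deg v ≤ Δ) (A : Algorithm In Out r m) (P : LCL In Out)
    {τ s L q idb : ℕ} (hkeylt : ∀ β, key β < 2 ^ idb)
    (hq : (Δ + 1) * (2 ^ idb * Fintype.card In) ≤ 2 ^ q) (hL : (q + 1) * Δ ^ (2 * s) ≤ L * b)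
    (hev : Evaluable Q key (2 * s) A P τ b) (hb : 2 * Δ ^ (2 * s) ≤ b)
    (y : Bits r' → ℕ → Bits r) (k : ℕ) :
    ∃ A' : Algorithm In Out r' b, A'.rounds = 2 * s * L + k * (τ + 3 * s) + τ ∧
      ∀ N ρ, Q N ρ → ∀ v, A'.run N ρ v = A.run N (assignment (NotAccepted A P N)
        (N.Reach (2 * s)) (fun u => key (ρ u)) (fun v => {u | N.Reach s v u})
        (fun u => y (ρ u)) k) v := by
  let Z : Finset (ℕ × ℕ × In) :=
    Finset.range (Δ + 1) ×ˢ (Finset.range (2 ^ idb) ×ˢ Finset.univ)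
  have hZ : (Z : Set (ℕ × ℕ × In)).ncard ≤ 2 ^ q := by
    rw [Set.ncard_coe_finset]
    simpa [Z] using hq
  have h0 : Computes Q 0 b fun (N : Network n In) ρ v =>
      (N.baseLabel (fun u => key (ρ u)) v, ρ v) :=
    computes_init fun d x β => ((d, key β, x), β)
  have h1 := (h0.gather hΔ hdeg (fun x => x.1) Z (Finset.finite_toSet Z) hZ (by
    intro N ρ hQ v
    simp only [Z, Finset.coe_product, Network.baseLabel, Set.mem_prod, Finset.mem_coe,
      Finset.mem_range, Finset.mem_univ, and_true]
    exact ⟨Nat.lt_succ_of_le (hdeg N ρ hQ v), hkeylt _⟩) L (2 * s) hL).map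
    fun x => (x.1.2, x.2)
  have h2 := computes_resamplings hΔ hdeg A P le_rfl hev hb y h1 k
  have h3 := (hev _ _ (fun x => y x.1.1 x.2) h2 fun N ρ v N' ρ' v' _ _ h =>
      (Prod.ext_iff.1 (Prod.ext_iff.1 h).1).2).map fun x => x.2.2
  rw [zero_add] at h3
  exact h3

end ResamplingAlgorithm

/-! ### Failure probability of the resampling algorithm -/

theorem pr_not_injective_le (n : ℕ) (X : Type) [Finite X] [Nonempty X] :
    pr (fun ι : Fin n → X => ¬ Function.Injective ι) ≤ (n : ℝ) ^ 2 / Nat.card X := by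
  classical
  have hpair : ∀ p : Fin n × Fin n, p.1 ≠ p.2 →
      pr (fun ι : Fin n → X => ι p.1 = ι p.2) ≤ 1 / Nat.card X := by
    intro p hp
    have hπ : Function.Injective ![p.1, p.2] := by
      intro a b hab
      fin_cases a <;> fin_cases b <;> simp_all
    have h1 := pr_comp_injective (S := X) hπ fun y : Fin 2 → X => y 0 = y 1
    refine (le_of_eq h1).trans (le_of_eq ?_)
    have h2 : Nat.card {y : Fin 2 → X // y 0 = y 1} = Nat.card X := by
      refine Nat.card_congr
        { toFun := fun y => y.1 0
          invFun := fun x => ⟨fun _ => x, rfl⟩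
          left_inv := fun y => Subtype.ext (funext fun i => ?_)
          right_inv := fun x => rfl }
      fin_cases i
      exacts [rfl, y.2]
    have h3 : (Nat.card X : ℝ) ≠ 0 := by exact_mod_cast Nat.card_pos.ne'
    unfold pr
    rw [h2, Nat.card_fun, Nat.card_fin]
    push_cast
    field_simp
  calc pr (fun ι : Fin n → X => ¬ Function.Injective ι)
      ≤ pr (fun ι : Fin n → X => ∃ p ∈ Finset.univ.filter fun p : Fin n × Fin n => p.1 ≠ p.2,
          ι p.1 = ι p.2) := by
        refine pr_mono fun ι hι => ?_
        obtain ⟨a, b, hab, hne⟩ := Function.not_injective_iff.1 hι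
        exact ⟨(a, b), by simpa using hne, hab⟩
    _ ≤ ∑ p ∈ Finset.univ.filter fun p : Fin n × Fin n => p.1 ≠ p.2, (1 : ℝ) / Nat.card X :=
        (pr_exists_mem_le _ _).trans
          (Finset.sum_le_sum fun p hp => hpair p (Finset.mem_filter.1 hp).2)
    _ ≤ ∑ p : Fin n × Fin n, (1 : ℝ) / Nat.card X :=
        Finset.sum_le_sum_of_subset_of_nonneg (Finset.filter_subset _ _)
          fun _ _ _ => by positivity
    _ = (n : ℝ) ^ 2 / Nat.card X := by
        simp only [Finset.sum_const, Finset.card_univ, Fintype.card_prod, Fintype.card_fin,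
          nsmul_eq_mul]
        push_cast
        ring

section Failure

variable {n r r' m b k idb Δ ζ : ℕ} {In Out : Type}

/-- The random bits of all vertices, split into the names and the table of samples. -/
def splitBits (e : Bits r' ≃ Bits idb × (Fin (k + 1) → Bits r)) :
    (Fin n → Bits r') ≃ (Fin n → Bits idb) × (Fin n × Fin (k + 1) → Bits r) :=
  ((Equiv.arrowCongr (Equiv.refl _) e).trans (Equiv.arrowProdEquivProdArrow _ _ _)).trans
    (Equiv.prodCongr (Equiv.refl _) (Equiv.curry _ _ _).symm)

/-- The resampling algorithm fails only if two names agree, or if an event still occurs after `k`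
steps of resampling. -/
theorem failureProb_le (hΔ : 2 ≤ Δ) (e : Bits r' ≃ Bits idb × (Fin (k + 1) → Bits r))
    (code : Bits idb ↪ ℕ) (A : Algorithm In Out r m) (P : LCL In Out) (hA : A.SolvesWHP P Δ ζ)
    {s : ℕ} (hs : A.rounds + 1 + P.radius ≤ s) (h1 : Δ ^ (s + 2) + Δ ^ 2 ≤ ζ)
    (h2 : 8 * Δ ^ (4 * s + 1) ≤ ζ) (A' : Algorithm In Out r' b) (N : Network n In)
    (hN : N.maxDegree = Δ)
    (hA' : ∀ ρ : Fin n → Bits r', (Function.Injective fun u => code (e (ρ u)).1) → ∀ v,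
      A'.run N ρ v = A.run N (assignment (NotAccepted A P N) (N.Reach (2 * s))
        (fun u => code (e (ρ u)).1) (fun v => {u | N.Reach s v u})
        (fun u c => (e (ρ u)).2 ⟨min c k, Nat.lt_succ_of_le (min_le_right c k)⟩) k) v) :
    A'.failureProb P N ≤ (n : ℝ) ^ 2 / 2 ^ idb +
      n * (4 * (1 / ζ : ℝ) * (4 * (1 / ζ : ℝ) * (Δ ^ (4 * s + 1) : ℕ)) ^ k) := by
  classical
  have hdeg : ∀ v, N.deg v ≤ Δ := fun v => hN ▸ N.deg_le_maxDegree v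
  have hζ : (0 : ℝ) < ζ := by
    have : 0 < Δ ^ (s + 2) := by positivity
    exact_mod_cast (by omega : 0 < ζ)
  let Bad : (Fin n → Bits idb) → (Fin n × Fin (k + 1) → Bits r) → Prop := fun ι x =>
    Function.Injective ι ∧ ∃ v, NotAccepted A P N v (assignment (NotAccepted A P N)
      (N.Reach (2 * s)) (fun u => code (ι u)) (fun v => {u | N.Reach s v u}) (extendTable k x) k)
  have hBad : ∀ ι, pr (Bad ι) ≤
      n * (4 * (1 / ζ : ℝ) * (4 * (1 / ζ : ℝ) * (Δ ^ (4 * s + 1) : ℕ)) ^ k) := by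
    intro ι
    by_cases hι : Function.Injective ι
    · refine (pr_mono fun x hx => hx.2).trans ?_
      have := pr_exists_viol_le (viol := NotAccepted A P N) (near := N.Reach (2 * s))
        (close := N.Reach (4 * s)) (key := fun u => code (ι u)) (vbl := fun v => {u | N.Reach s v u})
        (code.injective.comp hι) (fun e => Network.Reach.refl N _ e)
        (fun e f h => Network.Reach.symm h)
        (fun e f v he hf => (Network.Reach.trans he (Network.Reach.symm hf)).mono (by omega))
        (fun e f g h h' => ((Network.Reach.trans h h').symm).mono (by omega))
        (fun v => A.dependsOn_acceptsAt_run P N (by omega) v) (p := 1 / ζ) (by positivity)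
        (fun v => A.pr_not_acceptsAt_le P hΔ hA N hN hs h1 v) (D := Δ ^ (4 * s + 1))
        (by
          rw [mul_one_div, div_mul_eq_mul_div, div_le_one hζ]
          exact_mod_cast h2)
        (fun v => by
          refine le_trans (Nat.card_le_card_of_injective
            (Subtype.map (q := fun u => N.Reach (4 * s) v u) id fun u h => Network.Reach.symm h)
            (Subtype.map_injective _ Function.injective_id)) ?_
          exact N.card_reach_le hΔ hdeg (4 * s) v) k
      rwa [Fintype.card_fin] at this
    · have h0 : Bad ι = fun _ => False := funext fun x => eq_false fun h => hι h.1
      rw [h0, pr_false]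
      positivity
  have hpr : A'.failureProb P N = pr fun ρ => ¬ P.Accepts N (A'.run N ρ) := rfl
  rw [hpr]
  calc pr (fun ρ => ¬ P.Accepts N (A'.run N ρ))
      ≤ pr (fun ρ : Fin n → Bits r' => ¬ Function.Injective (splitBits e ρ).1 ∨
          Bad (splitBits e ρ).1 (splitBits e ρ).2) := by
        refine pr_mono fun ρ hρ => ?_
        by_cases hι : Function.Injective (splitBits e ρ).1
        · right
          refine ⟨hι, ?_⟩
          unfold LCL.Accepts at hρ
          push Not at hρ
          obtain ⟨v, hv⟩ := hρ
          refine ⟨v, ?_⟩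
          have hrun := funext (hA' ρ (code.injective.comp hι))
          rw [hrun] at hv
          exact hv
        · exact Or.inl hι
    _ = pr (fun ω : (Fin n → Bits idb) × (Fin n × Fin (k + 1) → Bits r) =>
          ¬ Function.Injective ω.1 ∨ Bad ω.1 ω.2) := pr_equiv (splitBits e)
            fun ω => ¬ Function.Injective ω.1 ∨ Bad ω.1 ω.2
    _ ≤ _ := by
        refine (pr_or_le _ _).trans (add_le_add ?_ (pr_prod_le Bad _ hBad))
        rw [pr_fst fun ι : Fin n → Bits idb => ¬ Function.Injective ι]
        refine (pr_not_injective_le n (Bits idb)).trans (le_of_eq ?_)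
        simp

/-- Parameters for which the failure probability is at most `1 / n`. Two names agree with
probability at most `1 / (2 * n)`. An event still occurs after `k` steps with probability at most
`1 / (2 * n)` as well, since `4 * D / ζ ≤ ζ ^ (-1 / 2)` for the bound `D = Δ ^ (4 * s + 1)` on the
number of close events. -/
theorem exists_solvesWHP [Nonempty In] [Fintype In] (hΔ : 2 ≤ Δ) (hn : 3 ≤ n)
    (A : Algorithm In Out r m) (P : LCL In Out) (hA : A.SolvesWHP P Δ ζ) {s q L τ : ℕ}
    (hs : A.rounds + 1 + P.radius ≤ s) (h1 : Δ ^ (s + 2) + Δ ^ 2 ≤ ζ)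
    (h2 : 8 * Δ ^ (4 * s + 1) ≤ ζ) (h3 : (4 * Δ ^ (4 * s + 1)) ^ 2 ≤ ζ) (hid : 2 * n ^ 3 ≤ 2 ^ idb)
    (hk : n ^ 6 ≤ ζ ^ k) (hq : (Δ + 1) * (2 ^ idb * Fintype.card In) ≤ 2 ^ q)
    (hL : (q + 1) * Δ ^ (2 * s) ≤ L * b) (hb : 2 * Δ ^ (2 * s) ≤ b)
    (hev : ∀ {r' : ℕ} (key : Bits r' → ℕ) (Q : Network n In → (Fin n → Bits r') → Prop),
      (∀ N ρ, Q N ρ → ∀ v, N.deg v ≤ Δ) →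
      (∀ N ρ, Q N ρ → Function.Injective fun u => key (ρ u)) → Evaluable Q key (2 * s) A P τ b) :
    ∃ A' : Algorithm In Out (idb + (k + 1) * r) b,
      A'.rounds = 2 * s * L + k * (τ + 3 * s) + τ ∧ A'.SolvesWHP P Δ n := by
  classical
  obtain ⟨e⟩ : Nonempty (Bits (idb + (k + 1) * r) ≃ Bits idb × (Fin (k + 1) → Bits r)) := by
    refine ⟨Fintype.equivOfCardEq ?_⟩
    simp only [Fintype.card_prod, Fintype.card_fun, Fintype.card_bool, Fintype.card_fin]
    rw [pow_add, mul_comm (k + 1) r, pow_mul]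
  let code : Bits idb ↪ ℕ := (Fintype.equivFin (Bits idb)).toEmbedding.trans Fin.valEmbedding
  have hcode : ∀ β, code β < 2 ^ idb := fun β => by
    have := (Fintype.equivFin (Bits idb) β).2
    simpa [code] using this
  let key : Bits (idb + (k + 1) * r) → ℕ := fun β => code (e β).1
  let Q : Network n In → (Fin n → Bits (idb + (k + 1) * r)) → Prop := fun N ρ =>
    N.maxDegree = Δ ∧ Function.Injective fun u => key (ρ u)
  have hdeg : ∀ N ρ, Q N ρ → ∀ v, N.deg v ≤ Δ := fun N ρ hQ v => hQ.1 ▸ N.deg_le_maxDegree v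
  obtain ⟨A', hr, hrun⟩ := exists_resampling_algorithm hΔ hdeg A P (fun β => hcode (e β).1) hq hL
    (hev key Q hdeg fun N ρ hQ => hQ.2) hb
    (fun β c => (e β).2 ⟨min c k, Nat.lt_succ_of_le (min_le_right c k)⟩) k
  refine ⟨A', hr, fun N hN => ?_⟩
  refine (failureProb_le hΔ e code A P hA hs h1 h2 A' N hN
    fun ρ hρ v => hrun N ρ ⟨hN, hρ⟩ v).trans ?_
  have hn0 : (3 : ℝ) ≤ n := by exact_mod_cast hn
  have hζ8 : (8 : ℝ) ≤ ζ := by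
    have : 1 ≤ Δ ^ (4 * s + 1) := Nat.one_le_pow _ _ (by omega)
    exact_mod_cast (by omega : 8 ≤ ζ)
  have hid' : 2 * (n : ℝ) ^ 3 ≤ 2 ^ idb := by exact_mod_cast hid
  have hk' : (n : ℝ) ^ 6 ≤ (ζ : ℝ) ^ k := by exact_mod_cast hk
  have h3' : (4 * ((Δ ^ (4 * s + 1) : ℕ) : ℝ)) ^ 2 ≤ ζ := by exact_mod_cast h3
  have hA1 : (n : ℝ) ^ 2 / 2 ^ idb ≤ 1 / (2 * n) := by
    rw [div_le_div_iff₀ (by positivity) (by positivity)]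
    nlinarith
  set D : ℝ := ((Δ ^ (4 * s + 1) : ℕ) : ℝ) with hD
  have hD0 : 0 ≤ D := by positivity
  have hA2 : (4 * (1 / ζ : ℝ) * D) ^ k ≤ 1 / (n : ℝ) ^ 3 := by
    have h4 : ((4 * (1 / ζ : ℝ) * D) ^ k) ^ 2 ≤ (1 / (n : ℝ) ^ 3) ^ 2 := by
      calc ((4 * (1 / ζ : ℝ) * D) ^ k) ^ 2 = ((4 * D) ^ 2 / (ζ : ℝ) ^ 2) ^ k := by
            rw [← pow_mul, mul_comm k 2, pow_mul]
            congr 1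
            field_simp
        _ ≤ (ζ / (ζ : ℝ) ^ 2) ^ k := by gcongr
        _ = 1 / (ζ : ℝ) ^ k := by
            rw [sq, div_mul_cancel_left₀ (by positivity), inv_pow, one_div]
        _ ≤ 1 / (n : ℝ) ^ 6 := by gcongr
        _ = (1 / (n : ℝ) ^ 3) ^ 2 := by rw [div_pow, ← pow_mul]; norm_num
    exact (pow_le_pow_iff_left₀ (by positivity) (by positivity) two_ne_zero).1 h4
  have hA3 : (n : ℝ) * (4 * (1 / ζ : ℝ) * (4 * (1 / ζ : ℝ) * D) ^ k) ≤ 1 / (2 * n) := by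
    calc (n : ℝ) * (4 * (1 / ζ : ℝ) * (4 * (1 / ζ : ℝ) * D) ^ k)
        ≤ n * (4 * (1 / 8 : ℝ) * (1 / (n : ℝ) ^ 3)) := by gcongr
      _ = 1 / (2 * n) * (1 / n) := by field_simp; norm_num
      _ ≤ 1 / (2 * n) * 1 := by
          gcongr
          rw [div_le_one (by positivity)]
          linarith
      _ = 1 / (2 * n) := mul_one _
  calc _ ≤ 1 / (2 * (n : ℝ)) + 1 / (2 * n) := add_le_add hA1 hA3
    _ = 1 / (n : ℝ) := by field_simp; norm_num

end Failure

/-! ### Estimates for the parameters -/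

theorem clog_le_logb_add_one {b x : ℕ} (hb : 2 ≤ b) (hx : 1 ≤ x) :
    (Nat.clog b x : ℝ) ≤ Real.logb b x + 1 := by
  rw [← Real.natCeil_logb_natCast]
  refine (Nat.ceil_lt_add_one (Real.logb_nonneg ?_ ?_)).le
  · exact_mod_cast hb
  · exact_mod_cast hx

/-- With `ε = 1 / 100` and `K₀ = 100 * (R + 10)`, the size `ζ` exceeds `Δ ^ (50 * s)` for the radius
`s = t + 1 + R` of dependence: both `C + R` and `ε * log_Δ ζ` are at most `log_Δ ζ / 100`. -/
theorem pow_le_of_rounds_le {R Δ t ζ : ℕ} (hΔ : 2 ≤ Δ) {C : ℝ} (hC : 1 ≤ C)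
    (hζ : ζ = ⌈(Δ : ℝ) ^ (((100 * (R + 10) : ℕ) : ℝ) * C)⌉₊)
    (ht : (t : ℝ) ≤ C + 1 / 100 * Real.logb Δ ζ) :
    50 * ((t + 1 + R : ℕ) + 7 : ℝ) ≤ Real.logb Δ ζ ∧ 1000 * C ≤ Real.logb Δ ζ ∧
      Real.logb Δ ζ ≤ (((100 * (R + 10) : ℕ) : ℝ) + 1) * C ∧ Δ < ζ ∧
      Δ ^ (50 * (t + 1 + R + 7)) ≤ ζ := by
  have hΔ1 : (1 : ℝ) < Δ := by exact_mod_cast hΔ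
  have hΔ2 : (2 : ℝ) ≤ Δ := by exact_mod_cast hΔ
  set K₀ : ℝ := ((100 * (R + 10) : ℕ) : ℝ) with hK₀
  have hK₀' : K₀ = 100 * (R + 10) := by rw [hK₀]; push_cast; ring
  have hR : (0 : ℝ) ≤ R := by positivity
  have hle : (Δ : ℝ) ^ (K₀ * C) ≤ ζ := by rw [hζ]; exact Nat.le_ceil _
  have hpos : (0 : ℝ) < (Δ : ℝ) ^ (K₀ * C) := by positivity
  have hζ0 : (0 : ℝ) < ζ := hpos.trans_le hle
  have hl : K₀ * C ≤ Real.logb Δ ζ := (Real.le_logb_iff_rpow_le hΔ1 hζ0).2 hle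
  have h1 : 50 * ((t + 1 + R : ℕ) + 7 : ℝ) ≤ Real.logb Δ ζ := by
    push_cast
    nlinarith
  have hKC : 1000 ≤ K₀ * C := by nlinarith
  have hpw : Δ ^ (50 * (t + 1 + R + 7)) ≤ ζ := by
    have h2 : (Δ : ℝ) ^ ((50 * (t + 1 + R + 7) : ℕ) : ℝ) ≤ ζ := by
      rw [← Real.le_logb_iff_rpow_le hΔ1 hζ0]
      refine le_trans (le_of_eq ?_) h1
      push_cast
      ring
    rw [Real.rpow_natCast] at h2
    exact_mod_cast h2
  refine ⟨h1, by nlinarith, ?_, ?_, hpw⟩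
  · rw [Real.logb_le_iff_le_rpow hΔ1 hζ0]
    have h3 : (ζ : ℝ) ≤ (Δ : ℝ) ^ (K₀ * C) + 1 := by
      rw [hζ]; exact (Nat.ceil_lt_add_one hpos.le).le
    have h4 : (1 : ℝ) ≤ (Δ : ℝ) ^ (K₀ * C) := Real.one_le_rpow hΔ1.le (by linarith)
    calc (ζ : ℝ) ≤ (Δ : ℝ) ^ (K₀ * C) * 2 := by linarith
      _ ≤ (Δ : ℝ) ^ (K₀ * C) * Δ := by gcongr
      _ = (Δ : ℝ) ^ (K₀ * C + 1) := by rw [Real.rpow_add (by linarith), Real.rpow_one]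
      _ ≤ (Δ : ℝ) ^ ((K₀ + 1) * C) := Real.rpow_le_rpow_of_exponent_le hΔ1.le (by linarith)
  · refine lt_of_lt_of_le ?_ hpw
    calc Δ = Δ ^ 1 := (pow_one Δ).symm
      _ < Δ ^ (50 * (t + 1 + R + 7)) := Nat.pow_lt_pow_right (by omega) (by omega)

/-- The number of rounds: `2 * s * L` for gathering the views, and `k` steps of at most `4 * s`
rounds. A view has at most `(q + 1) * Δ ^ (2 * s)` bits, where `q = O(Δ ^ (C + 1) * log_Δ n)` bounds the
length of a label, and `ζ`-bit messages are long enough to make `s * L` of order `log_Δ n`. -/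
theorem rounds_le {Δ n ζ s τ k q : ℕ} (hΔ : 2 ≤ Δ) {C K₀ : ℝ} (hC : 1 ≤ C)
    (hK₀ : 0 ≤ K₀) (hs : 50 * ((s : ℝ) + 7) ≤ Real.logb Δ ζ) (hC1 : 1000 * C ≤ Real.logb Δ ζ)
    (hζ : Real.logb Δ ζ ≤ (K₀ + 1) * C) (hζ0 : 0 < ζ) (hCn : C ≤ Real.logb Δ n) (hτ : τ ≤ s)
    (hk : (k : ℝ) ≤ 6 * (Real.logb Δ n / Real.logb Δ ζ) + 1)
    (hq : (q : ℝ) + 1 ≤ 9 * (Δ : ℝ) ^ C * (Δ * Real.logb Δ n)) :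
    ((2 * s * ((q + 1) * Δ ^ (2 * s) / ζ + 1) + k * (τ + 3 * s) + τ : ℕ) : ℝ) ≤
      4 * (K₀ + 2) * Real.logb Δ n := by
  have hΔ1 : (1 : ℝ) < Δ := by exact_mod_cast hΔ
  have hΔ2 : (2 : ℝ) ≤ Δ := by exact_mod_cast hΔ
  have hζ0' : (0 : ℝ) < ζ := by exact_mod_cast hζ0
  set l : ℝ := Real.logb Δ n with hl
  set z : ℝ := Real.logb Δ ζ with hz
  have hz0 : 0 < z := by linarith
  have hzl : z ≤ (K₀ + 1) * l := hζ.trans (by gcongr)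
  have hdiv : (((q + 1) * Δ ^ (2 * s) / ζ : ℕ) : ℝ) ≤ ((q : ℝ) + 1) * (Δ : ℝ) ^ (2 * s) / ζ := by
    refine Nat.cast_div_le.trans (le_of_eq ?_)
    push_cast
    ring
  have hmain : 2 * (s : ℝ) * (((q : ℝ) + 1) * (Δ : ℝ) ^ (2 * s) / ζ) ≤ l := by
    have h1 : (s : ℝ) ≤ (Δ : ℝ) ^ s := by exact_mod_cast (Nat.lt_pow_self (by omega)).le
    have h2 : (18 : ℝ) ≤ (Δ : ℝ) ^ 5 := by
      calc (18 : ℝ) ≤ 2 ^ 5 := by norm_num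
        _ ≤ (Δ : ℝ) ^ 5 := by gcongr
    have h3 : (Δ : ℝ) ^ (3 * s + 6) * (Δ : ℝ) ^ C ≤ ζ := by
      rw [← Real.rpow_natCast, ← Real.rpow_add (by linarith), ← Real.le_logb_iff_rpow_le hΔ1 hζ0']
      push_cast
      linarith
    have h4 : (0 : ℝ) < (Δ : ℝ) ^ C := by positivity
    rw [← mul_div_assoc, div_le_iff₀ hζ0']
    calc 2 * (s : ℝ) * (((q : ℝ) + 1) * (Δ : ℝ) ^ (2 * s))
        ≤ 2 * (Δ : ℝ) ^ s * (9 * (Δ : ℝ) ^ C * (Δ * l) * (Δ : ℝ) ^ (2 * s)) := by gcongr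
      _ = 18 * (Δ : ℝ) ^ (3 * s + 1) * (Δ : ℝ) ^ C * l := by ring
      _ ≤ (Δ : ℝ) ^ 5 * (Δ : ℝ) ^ (3 * s + 1) * (Δ : ℝ) ^ C * l := by
          have : 0 ≤ l := by linarith
          gcongr
      _ = l * ((Δ : ℝ) ^ (3 * s + 6) * (Δ : ℝ) ^ C) := by ring
      _ ≤ l * ζ := by
          have : 0 ≤ l := by linarith
          gcongr
  have hτ' : (τ : ℝ) ≤ s := by exact_mod_cast hτ
  have hs0 : (0 : ℝ) ≤ s := by positivity
  have hks : (k : ℝ) * (τ + 3 * s) ≤ l + z := by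
    calc (k : ℝ) * (τ + 3 * s) ≤ (6 * (l / z) + 1) * (z / 10) := by
          gcongr
          · have : 0 ≤ l / z := div_nonneg (by linarith) hz0.le
            linarith
          · linarith
      _ = 6 / 10 * l + z / 10 := by field_simp
      _ ≤ l + z := by linarith
  push_cast at hdiv ⊢
  have h5 : 2 * (s : ℝ) * (((((q + 1) * Δ ^ (2 * s) / ζ : ℕ) : ℝ)) + 1) ≤ l + 2 * s := by
    have : 2 * (s : ℝ) * ((((q + 1) * Δ ^ (2 * s) / ζ : ℕ) : ℝ)) ≤ l :=
      le_trans (by gcongr) hmain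
    linarith
  nlinarith

/-- The logarithmic length of a label with degree, name and input. -/
theorem label_length_le {Δ n q idb c : ℕ} (hΔ : 2 ≤ Δ) (hn : Δ < n) {C : ℝ} (hC : 1 ≤ C)
    (hc : 1 ≤ c) (hcn : (c : ℝ) ≤ (n : ℝ) ^ ((Δ : ℝ) ^ C)) (hid : idb = Nat.clog 2 (2 * n ^ 3))
    (hq : q = Nat.clog 2 ((Δ + 1) * (2 ^ idb * c))) :
    (idb : ℝ) ≤ 2 + 3 * Real.logb 2 n ∧
      (q : ℝ) + 1 ≤ 9 * (Δ : ℝ) ^ C * (Δ * Real.logb Δ n) := by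
  have hΔ1 : (1 : ℝ) < Δ := by exact_mod_cast hΔ
  have hn2 : (2 : ℝ) ≤ n := by exact_mod_cast hΔ.trans hn.le
  have hn0 : (0 : ℝ) < n := by linarith
  set μ : ℝ := Real.logb 2 n with hμ
  have hμ1 : 1 ≤ μ := by
    rw [hμ, Real.le_logb_iff_rpow_le (by norm_num) hn0, Real.rpow_one]
    exact hn2
  have hid' : (idb : ℝ) ≤ 2 + 3 * μ := by
    have h1 := clog_le_logb_add_one (b := 2) (x := 2 * n ^ 3) le_rfl
      (Nat.mul_pos two_pos (pow_pos (by omega) 3))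
    rw [← hid] at h1
    push_cast at h1
    rw [Real.logb_mul (by norm_num) (by positivity), Real.logb_self_eq_one (by norm_num),
      Real.logb_pow] at h1
    push_cast at h1
    linarith
  refine ⟨hid', ?_⟩
  have hc0 : (0 : ℝ) < c := by exact_mod_cast hc
  have hq' : (q : ℝ) ≤ 1 + (μ + (idb + (Δ : ℝ) ^ C * μ)) := by
    have h1 := clog_le_logb_add_one (b := 2) (x := (Δ + 1) * (2 ^ idb * c)) le_rfl
      (Nat.one_le_iff_ne_zero.2 (by positivity))
    rw [← hq] at h1
    push_cast at h1
    rw [Real.logb_mul (by positivity) (by positivity), Real.logb_mul (by positivity) (by positivity),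
      Real.logb_pow, Real.logb_self_eq_one (by norm_num)] at h1
    have h2 : Real.logb 2 (Δ + 1) ≤ μ := by
      refine Real.logb_le_logb_of_le (by norm_num) (by positivity) ?_
      exact_mod_cast hn
    have h3 : Real.logb 2 c ≤ (Δ : ℝ) ^ C * μ := by
      refine (Real.logb_le_logb_of_le (by norm_num) hc0 hcn).trans (le_of_eq ?_)
      rw [Real.logb_rpow_eq_mul_logb_of_pos hn0]
    linarith
  have hΔC : 1 ≤ (Δ : ℝ) ^ C := Real.one_le_rpow hΔ1.le (by linarith)
  have hμl : μ ≤ Δ * Real.logb Δ n := by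
    have h1 : Real.logb 2 Δ ≤ Δ := by
      rw [Real.logb_le_iff_le_rpow (by norm_num) (by linarith), Real.rpow_natCast]
      exact_mod_cast Nat.lt_two_pow_self.le
    have h2 : μ = Real.logb 2 Δ * Real.logb Δ n :=
      (Real.mul_logb (by positivity) (by linarith) (by linarith)).symm
    rw [h2]
    have h3 : 0 ≤ Real.logb Δ n := Real.logb_nonneg hΔ1 (by linarith)
    gcongr
  calc (q : ℝ) + 1 ≤ 8 * μ + (Δ : ℝ) ^ C * μ := by linarith
    _ ≤ 9 * (Δ : ℝ) ^ C * μ := by nlinarith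
    _ ≤ 9 * (Δ : ℝ) ^ C * (Δ * Real.logb Δ n) := by gcongr

/-- The message size `b`: the smaller one of what the two ways of evaluating `A` need. -/
theorem exists_evaluable_size {Δ R J ζ r m n : ℕ} {In Out : Type} [Nonempty In] [Fintype Out]
    (hΔ : 2 ≤ Δ) (A : Algorithm In Out r m) (P : LCL In Out) (hR : P.radius ≤ R) (hr : 1 ≤ r)
    (hJ : A.rounds + 1 + R ≤ J) (hζ : Δ ^ (A.rounds + 1 + R) ≤ ζ) {K : ℝ} (hK : (R : ℝ) ≤ K)
    (hK3 : 3 ≤ K) :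
    ∃ b : ℕ, ζ ≤ b ∧ (b : ℝ) ≤ K * min
        (Real.log (Fintype.card Out) * (Δ : ℝ) ^ K + m + ζ) ((r : ℝ) * ζ) ∧
      ∀ {r' : ℕ} (key : Bits r' → ℕ) (Q : Network n In → (Fin n → Bits r') → Prop),
        (∀ N ρ, Q N ρ → ∀ v, N.deg v ≤ Δ) →
        (∀ N ρ, Q N ρ → Function.Injective fun u => key (ρ u)) →
        Evaluable Q key J A P (A.rounds + P.radius) b := by
  have hΔ1 : (1 : ℝ) < Δ := by exact_mod_cast hΔ
  have hOut : Nonempty Out := ⟨A.output 0 (A.init 0 (Classical.arbitrary In) fun _ => false)⟩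
  have hpow : ∀ {j}, j ≤ A.rounds + R → 2 * Δ ^ j ≤ ζ := fun {j} hj =>
    calc 2 * Δ ^ j ≤ Δ * Δ ^ (A.rounds + R) :=
          Nat.mul_le_mul hΔ (Nat.pow_le_pow_right (by omega) hj)
      _ = Δ ^ (A.rounds + 1 + R) := by ring
      _ ≤ ζ := hζ
  rcases le_total (Real.log (Fintype.card Out) * (Δ : ℝ) ^ K + m + ζ) ((r : ℝ) * ζ) with h | h
  · refine ⟨(Nat.clog 2 (Nat.card Out) + 1) * Δ ^ P.radius + m + ζ, by omega, ?_,
      fun key Q hdeg hkey => evaluable_of_simulation hΔ hdeg hkey A P (by omega) (by omega)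
        (Nat.le_pow_clog (by omega) _) (by omega)⟩
    rw [min_eq_left h]
    have hcard : 1 ≤ Nat.card Out := Nat.card_pos
    have h1 := clog_le_logb_add_one (b := 2) le_rfl hcard
    have h2 : Real.logb 2 (Nat.card Out) ≤ 2 * Real.log (Fintype.card Out) := by
      rw [Nat.card_eq_fintype_card, Real.logb, div_le_iff₀ (Real.log_pos (by norm_num))]
      have h3 : 0 ≤ Real.log (Fintype.card Out) := Real.log_natCast_nonneg _
      have h4 := Real.log_two_gt_d9
      nlinarith
    have h3 : (Δ : ℝ) ^ P.radius ≤ (Δ : ℝ) ^ K := by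
      rw [← Real.rpow_natCast]
      refine Real.rpow_le_rpow_of_exponent_le hΔ1.le (le_trans ?_ hK)
      exact_mod_cast hR
    have h4 : 2 * (Δ : ℝ) ^ P.radius ≤ ζ := by
      exact_mod_cast hpow (by omega : P.radius ≤ A.rounds + R)
    have h5 : 0 ≤ Real.log (Fintype.card Out) := Real.log_natCast_nonneg _
    have h6 : 0 ≤ Real.log (Fintype.card Out) * (Δ : ℝ) ^ K := by positivity
    have h7 : (0 : ℝ) ≤ m := by positivity
    have h8 : (0 : ℝ) ≤ ζ := by positivity
    push_cast at h1 ⊢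
    calc ((Nat.clog 2 (Nat.card Out) : ℝ) + 1) * (Δ : ℝ) ^ P.radius + m + ζ
        ≤ (2 * Real.log (Fintype.card Out) + 2) * (Δ : ℝ) ^ P.radius + m + ζ := by
          refine add_le_add_left (add_le_add_left ?_ _) _
          exact mul_le_mul_of_nonneg_right (by linarith) (by positivity)
      _ = 2 * (Real.log (Fintype.card Out) * (Δ : ℝ) ^ P.radius) + 2 * (Δ : ℝ) ^ P.radius +
            m + ζ := by
          ring
      _ ≤ 2 * (Real.log (Fintype.card Out) * (Δ : ℝ) ^ K) + ζ + m + ζ := by gcongr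
      _ ≤ 3 * (Real.log (Fintype.card Out) * (Δ : ℝ) ^ K + m + ζ) := by linarith
      _ ≤ K * (Real.log (Fintype.card Out) * (Δ : ℝ) ^ K + m + ζ) := by gcongr
  · refine ⟨r * ζ, Nat.le_mul_of_pos_left _ hr, ?_,
      fun key Q hdeg hkey => evaluable_of_gather_bits hΔ hdeg hkey A P (by omega) ?_⟩
    · rw [min_eq_right h]
      push_cast
      have : (0 : ℝ) ≤ r * ζ := by positivity
      nlinarith
    · calc (r + 1) * Δ ^ (A.rounds + P.radius) ≤ (r * 2) * Δ ^ (A.rounds + P.radius) :=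
            Nat.mul_le_mul_right _ (by omega)
        _ = r * (2 * Δ ^ (A.rounds + P.radius)) := by ring
        _ ≤ r * ζ := Nat.mul_le_mul_left _ (hpow (by omega))

/-- The theorem for one pair of parameters `Δ` and `n`. -/
theorem exists_fast_algorithm {R Δ n ζ r m : ℕ} {In Out : Type} [Fintype In] [Fintype Out]
    (hΔ : 2 ≤ Δ) (hn : Δ < n) (A : Algorithm In Out r m) (P : LCL In Out) (hR : P.radius ≤ R)
    (hr : 1 ≤ r) {C : ℝ} (hC : 1 ≤ C)
    (hζ : ζ = ⌈(Δ : ℝ) ^ (((100 * (R + 10) : ℕ) : ℝ) * C)⌉₊)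
    (ht : (A.rounds : ℝ) ≤ C + 1 / 100 * Real.logb Δ ζ) (hA : A.SolvesWHP P Δ ζ)
    (hCn : (Δ : ℝ) ^ C ≤ n) (hIn : (Fintype.card In : ℝ) ≤ (n : ℝ) ^ ((Δ : ℝ) ^ C)) {K : ℝ}
    (hK : K = ((1000 * (R + 20) : ℕ) : ℝ)) :
    ∃ (r' b : ℕ) (A' : Algorithm In Out r' b), A'.SolvesWHP P Δ n ∧
      (A'.rounds : ℝ) ≤ K * Real.logb Δ n ∧
      (r' : ℝ) ≤ K * (Real.log n + r * Real.logb ζ n) ∧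
      (b : ℝ) ≤ K * min (Real.log (Fintype.card Out) * (Δ : ℝ) ^ K + m + ζ) ((r : ℝ) * ζ) := by
  have hΔ1 : (1 : ℝ) < Δ := by exact_mod_cast hΔ
  have hn0 : (0 : ℝ) < n := by exact_mod_cast (by omega : 0 < n)
  have hn3 : (3 : ℝ) ≤ n := by exact_mod_cast (by omega : 3 ≤ n)
  have hR0 : (0 : ℝ) ≤ R := by positivity
  have hK' : K = 1000 * (R + 20) := by rw [hK]; push_cast; ring
  obtain ⟨h1, h2, h3, h4, h5⟩ := pow_le_of_rounds_le hΔ hC hζ ht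
  have hζ1 : (1 : ℝ) < ζ := by exact_mod_cast (by omega : 1 < ζ)
  have hl : C ≤ Real.logb Δ n := (Real.le_logb_iff_rpow_le hΔ1 hn0).2 hCn
  have hratio : Real.logb ζ n = Real.logb Δ n / Real.logb Δ ζ := by
    have : Real.log Δ ≠ 0 := (Real.log_pos hΔ1).ne'
    simp only [Real.logb]
    field_simp
  have hratio0 : 0 ≤ Real.logb ζ n := Real.logb_nonneg hζ1 (by linarith)
  have hlog : 1 ≤ Real.log n := by
    rw [Real.le_log_iff_exp_le hn0]
    have := Real.exp_one_lt_d9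
    linarith
  rcases isEmpty_or_nonempty In with hE | hE
    -- Without input labels there is no network with `n > 0` vertices.
  · refine ⟨0, 0,
      { rounds := 0
        State := fun _ => In
        init := fun _ x _ => x
        send := fun _ x => hE.elim x
        receive := fun _ x _ => x
        output := fun _ x => hE.elim x }, fun N _ => hE.elim (N.input ⟨0, by omega⟩), ?_, ?_, ?_⟩
    · have : 0 ≤ K * Real.logb Δ n := by nlinarith
      simpa using this
    · have : 0 ≤ (r : ℝ) * Real.logb ζ n := by positivity
      push_cast
      nlinarith
    · have : (0 : ℝ) ≤ Real.log (Fintype.card Out) := Real.log_natCast_nonneg _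
      have hK0 : 0 ≤ K := by linarith
      push_cast
      positivity
  · set s := A.rounds + 1 + R with hs
    have hpow : ∀ {j}, j ≤ 50 * (s + 7) → Δ ^ j ≤ ζ := fun hj =>
      (Nat.pow_le_pow_right (by omega) hj).trans h5
    have hc : 1 ≤ Fintype.card In := Fintype.card_pos
    obtain ⟨hid, hq⟩ := label_length_le hΔ hn hC hc hIn rfl rfl
    set idb := Nat.clog 2 (2 * n ^ 3) with hidb
    set q := Nat.clog 2 ((Δ + 1) * (2 ^ idb * Fintype.card In)) with hqdef
    set k := Nat.clog ζ (n ^ 6) with hkdef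
    obtain ⟨b, hb1, hb2, hev⟩ := exists_evaluable_size (n := n) (J := 2 * s) hΔ A P hR hr (by omega)
      (hpow (by omega)) (K := K) (by linarith) (by linarith)
    have hdouble : ∀ j, 2 * Δ ^ j ≤ Δ ^ (j + 1) := fun j => by
      rw [pow_succ']; exact Nat.mul_le_mul_right _ hΔ
    have hL : (q + 1) * Δ ^ (2 * s) ≤ ((q + 1) * Δ ^ (2 * s) / ζ + 1) * b := by
      refine le_trans ?_ (Nat.mul_le_mul_left _ hb1)
      rw [mul_comm _ ζ]
      exact (Nat.lt_mul_div_succ _ (by omega)).le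
    obtain ⟨A', hrounds, hsolve⟩ := exists_solvesWHP (n := n) (idb := idb) (k := k) (q := q) (s := s)
      (L := (q + 1) * Δ ^ (2 * s) / ζ + 1) hΔ (by omega) A P hA (by omega)
      (by
        have e1 : Δ ^ 2 ≤ Δ ^ (s + 2) := Nat.pow_le_pow_right (by omega) (by omega)
        have e2 := hdouble (s + 2)
        have e3 := hpow (j := s + 2 + 1) (by omega)
        omega)
      (by
        have e1 := hdouble (4 * s + 1)
        have e2 := hdouble (4 * s + 1 + 1)
        have e3 := hdouble (4 * s + 1 + 1 + 1)
        have e4 := hpow (j := 4 * s + 1 + 1 + 1 + 1) (by omega)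
        omega)
      (by
        have e1 := hdouble (4 * s + 1)
        have e2 := hdouble (4 * s + 1 + 1)
        calc (4 * Δ ^ (4 * s + 1)) ^ 2 ≤ (Δ ^ (4 * s + 1 + 1 + 1)) ^ 2 :=
              Nat.pow_le_pow_left (by omega) 2
          _ = Δ ^ ((4 * s + 1 + 1 + 1) * 2) := (pow_mul _ _ _).symm
          _ ≤ ζ := hpow (by omega))
      (Nat.le_pow_clog (by omega) _) (Nat.le_pow_clog (by omega) _) (Nat.le_pow_clog (by omega) _)
      hL ((hdouble (2 * s)).trans ((hpow (by omega)).trans hb1)) hev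
    have hk : (k : ℝ) ≤ 6 * Real.logb ζ n + 1 := by
      have := clog_le_logb_add_one (b := ζ) (x := n ^ 6) (by omega)
        (Nat.one_le_pow _ _ (by omega))
      push_cast at this
      rw [Real.logb_pow] at this
      push_cast at this
      exact this
    refine ⟨_, b, A', hsolve, ?_, ?_, hb2⟩
    · rw [hrounds]
      refine (rounds_le hΔ hC (K₀ := ((100 * (R + 10) : ℕ) : ℝ)) (by positivity) h1 h2 h3 (by omega)
        hl (by omega) (by rwa [← hratio]) hq).trans ?_
      have : 0 ≤ Real.logb Δ n := by linarith
      push_cast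
      rw [hK']
      nlinarith
    · have hz0 : 0 < Real.logb Δ ζ := by linarith
      have hinv : 1 ≤ (100 * (R + 10) + 1 : ℝ) * Real.logb ζ n := by
        rw [hratio, ← mul_div_assoc, le_div_iff₀ hz0, one_mul]
        refine h3.trans ?_
        push_cast
        gcongr
      have hid2 : Real.logb 2 n ≤ 2 * Real.log n := by
        rw [Real.logb, div_le_iff₀ (Real.log_pos (by norm_num))]
        have := Real.log_two_gt_d9
        nlinarith
      have hr1 : (1 : ℝ) ≤ r := by exact_mod_cast hr
      push_cast
      calc (idb : ℝ) + (k + 1) * r ≤ 8 * Real.log n +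
            (6 * Real.logb ζ n + 2 * ((100 * (R + 10) + 1 : ℝ) * Real.logb ζ n)) * r := by
            refine add_le_add (by linarith) ?_
            exact mul_le_mul_of_nonneg_right (by linarith) (by linarith)
        _ = 8 * Real.log n + (200 * R + 2008) * (r * Real.logb ζ n) := by ring
        _ ≤ K * Real.log n + K * (r * Real.logb ζ n) := by
            gcongr
            · rw [hK']; linarith
            · rw [hK']; linarith
        _ = K * (Real.log n + r * Real.logb ζ n) := by ring

end RandLOCAL

theorem mainTheorem5 :
    ∃ ε : ℝ, 0 < ε ∧ ∀ R : ℕ, ∃ K₀ K : ℕ, 1 ≤ K₀ ∧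
      ∀ (In Out : ℕ → Type) [∀ Δ, Fintype (In Δ)] [∀ Δ, Fintype (Out Δ)]
        (P : (Δ : ℕ) → RandLOCAL.LCL (In Δ) (Out Δ))
        (C : ℕ → ℝ) (r m : ℕ → ℕ → ℕ)
        (A : (Δ n : ℕ) → RandLOCAL.Algorithm (In Δ) (Out Δ) (r Δ n) (m Δ n)),
        (∀ Δ, 2 ≤ Δ → (P Δ).radius ≤ R) →
        (∀ Δ, 2 ≤ Δ → 1 ≤ C Δ) →
        (∀ Δ n, 2 ≤ Δ → Δ < n → 1 ≤ r Δ n) →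
        (∀ Δ n, 2 ≤ Δ → Δ < n → ((A Δ n).rounds : ℝ) ≤ C Δ + ε * Real.logb Δ n) →
        (∀ Δ n, 2 ≤ Δ → Δ < n → (A Δ n).SolvesWHP (P Δ) Δ n) →
        ∀ ζ : ℕ → ℕ, (∀ Δ, ζ Δ = ⌈(Δ : ℝ) ^ ((K₀ : ℝ) * C Δ)⌉₊) →
        ∃ (r' m' : ℕ → ℕ → ℕ)
          (A' : (Δ n : ℕ) → RandLOCAL.Algorithm (In Δ) (Out Δ) (r' Δ n) (m' Δ n)),
          (∀ Δ n, 2 ≤ Δ → Δ < n → (A' Δ n).SolvesWHP (P Δ) Δ n) ∧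
          ∀ Δ n : ℕ, 2 ≤ Δ → Δ < n →
            (Δ : ℝ) ^ C Δ ≤ n →
            (Fintype.card (In Δ) : ℝ) ≤ (n : ℝ) ^ ((Δ : ℝ) ^ C Δ) →
            ((A' Δ n).rounds : ℝ) ≤ K * Real.logb Δ n ∧
            (r' Δ n : ℝ) ≤ K * (Real.log n + r Δ (ζ Δ) * Real.logb (ζ Δ) n) ∧
            (m' Δ n : ℝ) ≤ K * min
              (Real.log (Fintype.card (Out Δ)) * (Δ : ℝ) ^ K + m Δ (ζ Δ) + ζ Δ)
              ((r Δ (ζ Δ) : ℝ) * ζ Δ) := by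
  classical
  refine ⟨1 / 100, by norm_num, fun R => ⟨100 * (R + 10), 1000 * (R + 20), by omega, ?_⟩⟩
  intro In Out _ _ P C r m A hrad hC hr hrounds hsolve ζ hζ
  have main : ∀ Δ n : ℕ, ∃ (r' m' : ℕ) (A' : RandLOCAL.Algorithm (In Δ) (Out Δ) r' m'),
      (2 ≤ Δ → Δ < n → A'.SolvesWHP (P Δ) Δ n) ∧
      (2 ≤ Δ → Δ < n → (Δ : ℝ) ^ C Δ ≤ n →
        (Fintype.card (In Δ) : ℝ) ≤ (n : ℝ) ^ ((Δ : ℝ) ^ C Δ) →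
        (A'.rounds : ℝ) ≤ (1000 * (R + 20) : ℕ) * Real.logb Δ n ∧
        (r' : ℝ) ≤ (1000 * (R + 20) : ℕ) * (Real.log n + r Δ (ζ Δ) * Real.logb (ζ Δ) n) ∧
        (m' : ℝ) ≤ (1000 * (R + 20) : ℕ) * min
          (Real.log (Fintype.card (Out Δ)) * (Δ : ℝ) ^ (1000 * (R + 20)) + m Δ (ζ Δ) + ζ Δ)
          ((r Δ (ζ Δ) : ℝ) * ζ Δ)) := by
    intro Δ n
    by_cases h : 2 ≤ Δ ∧ Δ < n ∧ (Δ : ℝ) ^ C Δ ≤ n ∧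
        (Fintype.card (In Δ) : ℝ) ≤ (n : ℝ) ^ ((Δ : ℝ) ^ C Δ)
    · obtain ⟨hΔ, hn, hCn, hIn⟩ := h
      have hlt : Δ < ζ Δ := by
        have h1 : (Δ : ℝ) ^ (2 : ℝ) ≤ ζ Δ := by
          rw [hζ Δ]
          refine le_trans ?_ (Nat.le_ceil _)
          refine Real.rpow_le_rpow_of_exponent_le (by exact_mod_cast (by omega : 1 ≤ Δ)) ?_
          push_cast
          have := hC Δ hΔ
          nlinarith [(Nat.cast_nonneg R : (0 : ℝ) ≤ R)]
        rw [Real.rpow_two] at h1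
        have h2 : Δ ^ 2 ≤ ζ Δ := by exact_mod_cast h1
        nlinarith
      obtain ⟨r', b, A', h1, h2, h3, h4⟩ := RandLOCAL.exists_fast_algorithm hΔ hn (A Δ (ζ Δ)) (P Δ)
        (hrad Δ hΔ) (hr Δ _ hΔ hlt) (hC Δ hΔ) (hζ Δ) (hrounds Δ _ hΔ hlt) (hsolve Δ _ hΔ hlt)
        hCn hIn rfl
      rw [Real.rpow_natCast] at h4
      exact ⟨r', b, A', fun _ _ => h1, fun _ _ _ _ => ⟨h2, h3, h4⟩⟩
      -- No bounds are claimed for the remaining parameters, and `A` itself can be used.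
    · exact ⟨r Δ n, m Δ n, A Δ n, hsolve Δ n,
        fun h1 h2 h3 h4 => absurd ⟨h1, h2, h3, h4⟩ h⟩
  choose r' m' A' h1 h2 using main
  exact ⟨r', m', A', h1, h2⟩
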